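/- Let $D$ be the open unit disk in $\mathbb C$. Test functions $\varphi\in C^\infty(\partial D)$ are written as smooth $2\pi$-periodic complex-valued functions of the angle. Let $H_b$ be the set of holomorphic functions $h$ on $D$ such that $$\langle h_b,\varphi\rangle:=\lim_{r\nearrow1}\int_0^{2\pi}h(re^{i\theta})\varphi(\theta)\,d\theta$$ exists for every $\varphi\in C^\infty(\partial D)$. For a functional $T$ on $C^\infty(\partial D)$ put $\overline T(\varphi)=\overline{T(\overline\varphi)}$, $\operatorname{Re}T=\frac12(T+\overline T)$, $\operatorname{Im}T=\frac1{2i}(T-\overline T)$. For $\zeta,z\in D$ let $$K_f(z,\zeta)=\frac{f(\zeta)}{\zeta}\,\frac{\zeta+z}{\zeta-z}+\frac{\overline{f(\zeta)}}{\overline\zeta}\,\frac{1+z\overline\zeta}{1-z\overline\zeta},\qquad \mathcal T_D(f)(z)=-\frac1{2\pi}\iint_D K_f(z,\zeta)\,d\xi\,d\eta\quad(\zeta=\xi+i\eta),$$ and let $P_r(\theta)=\dfrac{1-r^2}{1-2r\cos\theta+r^2}$. **Theorem.** Let $f\in L^1(D)$ be such that also $f(\zeta)/\zeta\in L^1(D)$,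 let $h\in H_b$ and $c\in\mathbb R$. Put $I=\frac{i}{2\pi}\langle\operatorname{Im}h_b,1\rangle$ and, for $z=re^{i\theta}\in D$, $$w(z)=ic-I+\frac1{2\pi}\langle h_b,P_r(\theta-\cdot)\rangle+\mathcal T_D(f)(z).$$ Then the integral defining $\mathcal T_D(f)(z)$ converges absolutely for almost every $z\in D$ and for $z=0$, and $w$ solves the Schwarz boundary value problem $$\frac{\partial w}{\partial\bar z}=f,\qquad \operatorname{Re}w_b=\operatorname{Re}h_b,\qquad \operatorname{Im}w(0)=c$$ in the following sense. 1. $w$ is locally integrable on $D$ and $\partial w/\partial\bar z=f$ on $D$ in the sense of distributions: $\iint_D w\,\partial_{\bar z}\varphi\,d\xi\,d\eta=-\iint_D f\varphi\,d\xi\,d\eta$ for all $\varphi\in C_c^\infty(D)$. 2. Let $E$ be the set of $r\in(0,1)$ with $\int_0^{2\pi}\iint_D|K_f(re^{i\theta},\zeta)|\,d\xi\,d\eta\,d\theta<\infty$. Then $E$ has full measure in $(0,1)$, and $E=(0,1)$ if $f\in L^q(D)$ for some $q>1$. For $r\in E$ the function $\theta\mapsto w(re^{i\theta})$ is integrable on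 $(0,2\pi)$, for every $\varphi\in C^\infty(\partial D)$ the limit $$\langle w_b,\varphi\rangle:=\lim_{r\nearrow1,\ r\in E}\int_0^{2\pi}w(re^{i\theta})\varphi(\theta)\,d\theta$$ exists, and $\operatorname{Re}w_b=\operatorname{Re}h_b$ as functionals on $C^\infty(\partial D)$. 3. $\operatorname{Im}w(0)=c$. -/

import Mathlib

open MeasureTheory Filter Topology Set
open scoped ContDiff

namespace SchwarzDisk

noncomputable section

/-- The open unit disk `D`. -/
def D : Set ℂ := Metric.ball 0 1

/-- `C^∞(∂D)`: smooth complex functions on the unit circle, written as smooth `2π`-periodic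
functions of the angle. -/
abbrev CircleTest : Type :=
  {φ : ℝ → ℂ // ContDiff ℝ ∞ φ ∧ Function.Periodic φ (2 * Real.pi)}

/-- The constant test function `1`. -/
def oneTest : CircleTest := ⟨fun _ => 1, contDiff_const, fun _ => rfl⟩

/-- The complex conjugate of a test function. -/
def conjTest (φ : CircleTest) : CircleTest :=
  ⟨fun t => (starRingEnd ℂ) (φ.1 t), Complex.conjCLE.contDiff.comp φ.2.1,
    fun t => congrArg (starRingEnd ℂ) (φ.2.2 t)⟩

/-- The real part of a functional `T` on `C^∞(∂D)`, namely `(T + T̄) / 2` with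
`⟨T̄, φ⟩ = conj ⟨T, conj φ⟩`; for real-valued `φ` this is the real part of `⟨T, φ⟩`. -/
def rePart (T : CircleTest → ℂ) (φ : CircleTest) : ℂ :=
  (T φ + (starRingEnd ℂ) (T (conjTest φ))) / 2

/-- The imaginary part of a functional `T` on `C^∞(∂D)`, namely `(T - T̄) / (2i)`;
for real-valued `φ` this is the imaginary part of `⟨T, φ⟩`. -/
def imPart (T : CircleTest → ℂ) (φ : CircleTest) : ℂ :=
  (T φ - (starRingEnd ℂ) (T (conjTest φ))) / (2 * Complex.I)

/-- `u` has the boundary value `T` in the sense of distributions, the limit `r ↗ 1` being taken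
through the radii `r ∈ E`: the integrals of `u` over these circles exist and
`⟨T, φ⟩ = lim_{r ↗ 1, r ∈ E} ∫_0^{2π} u(r e^{iθ}) φ(θ) dθ` for all `φ ∈ C^∞(∂D)`.
For `E = (0,1)` this is the usual notion. -/
def HasBoundaryValue (E : Set ℝ) (u : ℂ → ℂ) (T : CircleTest → ℂ) : Prop :=
  (∀ r ∈ E, IntervalIntegrable (fun θ : ℝ => u (circleMap 0 r θ)) volume 0 (2 * Real.pi)) ∧
  ∀ φ : CircleTest,
    Tendsto (fun r : ℝ => ∫ θ in (0 : ℝ)..(2 * Real.pi), u (circleMap 0 r θ) * φ.1 θ)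
      (𝓝[E ∩ Iio 1] 1) (𝓝 (T φ))

/-- The Poisson kernel `P_r(θ) = (1 - r²) / (1 - 2 r cos θ + r²)`. -/
def poisson (r θ : ℝ) : ℝ := (1 - r ^ 2) / (1 - 2 * r * Real.cos θ + r ^ 2)

theorem poisson_denom_ne_zero {r : ℝ} (h0 : 0 ≤ r) (h1 : r < 1) (θ : ℝ) :
    1 - 2 * r * Real.cos θ + r ^ 2 ≠ 0 := by
  have h := Real.cos_le_one θ
  nlinarith [mul_nonneg h0 (sub_nonneg.2 h), mul_pos (sub_pos.2 h1) (sub_pos.2 h1)]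

theorem contDiff_poisson {r : ℝ} (h0 : 0 ≤ r) (h1 : r < 1) : ContDiff ℝ ∞ (poisson r) :=
  ContDiff.div contDiff_const
    ((contDiff_const.sub (contDiff_const.mul Real.contDiff_cos)).add contDiff_const)
    (poisson_denom_ne_zero h0 h1)

/-- The test function `P_r(θ - ·)`, where `r = |z| < 1` and `θ = arg z`. -/
def poissonTest (z : ℂ) (hz : ‖z‖ < 1) : CircleTest :=
  ⟨fun t => (poisson ‖z‖ (z.arg - t) : ℂ),
    Complex.ofRealCLM.contDiff.comp
      ((contDiff_poisson (norm_nonneg z) hz).comp (contDiff_const.sub contDiff_id)),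
    fun t => by
      have : Real.cos (z.arg - (t + 2 * Real.pi)) = Real.cos (z.arg - t) := by
        rw [← sub_sub, Real.cos_sub_two_pi]
      simp only [poisson, this]⟩

/-- The integrand
`(f(ζ)/ζ) (ζ+z)/(ζ-z) + (conj f(ζ) / conj ζ) (1 + z conj ζ)/(1 - z conj ζ)`
of the operator `𝒯_D`. -/
def kernel (f : ℂ → ℂ) (z ζ : ℂ) : ℂ :=
  f ζ / ζ * ((ζ + z) / (ζ - z)) +
    (starRingEnd ℂ) (f ζ) / (starRingEnd ℂ) ζ *
      ((1 + z * (starRingEnd ℂ) ζ) / (1 - z * (starRingEnd ℂ) ζ))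

/-- The operator `𝒯_D`. -/
def opT (f : ℂ → ℂ) (z : ℂ) : ℂ :=
  -(1 / (2 * (Real.pi : ℂ))) * ∫ ζ in D, kernel f z ζ

/-- The radii `r ∈ (0,1)` for which `∫_0^{2π} 𝒯_D(f)(r e^{iθ}) dθ`, written out as an iterated
integral in `ζ ∈ D` and `θ`, converges absolutely. -/
def admissibleRadii (f : ℂ → ℂ) : Set ℝ :=
  {r | r ∈ Ioo (0 : ℝ) 1 ∧
    Integrable (fun p : ℂ × ℝ => kernel f (circleMap 0 r p.2) p.1)
      ((volume.restrict D).prod (volume.restrict (Ioc 0 (2 * Real.pi))))}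

/-- The function
`w(z) = i c - I + (1/2π) ⟨h_b, P_r(θ - ·)⟩ + 𝒯_D(f)(z)`, `z = r e^{iθ} ∈ D`, with
`I = (i/2π) ⟨Im h_b, 1⟩`; its value outside the disk is irrelevant. -/
def schwarzSolution (f : ℂ → ℂ) (hb : CircleTest → ℂ) (c : ℝ) (z : ℂ) : ℂ :=
  if hz : ‖z‖ < 1 then
    Complex.I * c - Complex.I / (2 * (Real.pi : ℂ)) * imPart hb oneTest
      + 1 / (2 * (Real.pi : ℂ)) * hb (poissonTest z hz) + opT f z
  else 0

/-- The Cauchy-Riemann operator `∂/∂z̄ = (∂/∂x + i ∂/∂y) / 2` on smooth functions. -/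
def dbar (φ : ℂ → ℂ) (z : ℂ) : ℂ :=
  (fderiv ℝ φ z 1 + Complex.I * fderiv ℝ φ z Complex.I) / 2

/-- `∂w/∂z̄ = f` on `D` in the weak (distributional) sense. -/
def WeakDbarEq (w f : ℂ → ℂ) : Prop :=
  LocallyIntegrableOn w D ∧
  ∀ φ : ℂ → ℂ, ContDiff ℝ ∞ φ → HasCompactSupport φ → tsupport φ ⊆ D →
    ∫ z in D, w z * dbar φ z = -∫ z in D, f z * φ z

end

end SchwarzDisk

namespace SchwarzDisk

open scoped ENNReal ComplexConjugate

/-! Pairing `hb` with a Poisson kernel reproduces `h`: the dilations `h (ρ * z)` are holomorphic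
past the closed disk, so the Poisson formula applies to them, and `ρ → 1` gives `2π h z`. Hence on
`D` the solution is `i (c - Im h(0)) + h + 𝒯_D(f)` (`schwarzSolution_eq`), and everything reduces to
`𝒯_D(f)`.

Since `|1 - z conj ζ| ≥ |ζ - z|` on the disk, the kernel is at most `4 |f ζ / ζ| / |ζ - z|`
(`enorm_kernel_le`). This singularity is integrable in the plane, so Fubini gives absolute
convergence almost everywhere. As a function of `z`, the first fraction of the kernel is `-1 - 2ζ /
(z - ζ)` and the second is holomorphic, so the Cauchy–Pompeiu formula yields the differential
equation (`integral_kernel_mul_dbar`).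

On a circle `1 / |ζ - z|` need not be integrable uniformly in `ζ`. Interpolating between the radial
and the angular distance bounds its circle integral by a multiple of `|r - |ζ||^(-a)`. Tonelli then
gives almost every radius, and Hölder gives every radius when `f` is in some `L^q`, `q > 1`.

For the boundary limit, the integral of the kernel against a test function is at most `C |f ζ / ζ|`,
uniformly in `r` (`exists_norm_integral_kernel_mul_le`): subtracting the value of the test function
at `arg ζ` cancels the singularity, and the remaining circle integrals are explicit. Dominated
convergence moves the limit onto the unit circle, where the kernel is purely imaginary
(`conj_kernel_of_norm_eq_one`), so `𝒯_D(f)` contributes nothing to the real part. At `z = 0` the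
kernel is real, which settles the imaginary part there. -/

/-! ### Integrability of power singularities -/

theorem lintegral_ball_enorm_rpow_lt_top {E : Type*} [NormedAddCommGroup E] [NormedSpace ℝ E]
    [FiniteDimensional ℝ E] [Nontrivial E] [MeasurableSpace E] [BorelSpace E] (μ : Measure E)
    [μ.IsAddHaarMeasure] {b : ℝ} (hb : b < Module.finrank ℝ E) (R : ℝ) :
    ∫⁻ u in Metric.ball (0 : E) R, ‖u‖ₑ ^ (-b) ∂μ < ⊤ := by
  have hd : 0 < Module.finrank ℝ E := Module.finrank_pos
  have hint : Integrable (fun u : E => (Iio R).indicator (fun y : ℝ => y ^ (-b)) ‖u‖) μ := by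
    rw [integrable_fun_norm_addHaar μ (f := (Iio R).indicator (fun y : ℝ => y ^ (-b)))]
    have h1 : IntegrableOn (fun y : ℝ => y ^ ((Module.finrank ℝ E : ℝ) - 1 - b)) (Ioo 0 R) := by
      rcases le_or_gt R 0 with hR | hR
      · simp [Ioo_eq_empty (not_lt.2 hR)]
      · rw [intervalIntegral.integrableOn_Ioo_rpow_iff hR]; linarith
    have h2 : IntegrableOn ((Iio R).indicator
        (fun y : ℝ => y ^ ((Module.finrank ℝ E : ℝ) - 1 - b))) (Ioi 0) := by
      rw [integrableOn_indicator_iff measurableSet_Iio, inter_comm, Ioi_inter_Iio]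
      exact h1
    refine h2.congr_fun (fun y hy => ?_) measurableSet_Ioi
    have hy : 0 < y := hy
    by_cases hyR : y ∈ Iio R
    · simp only [indicator_of_mem hyR, smul_eq_mul]
      rw [← Real.rpow_natCast, ← Real.rpow_add hy, Nat.cast_sub hd]
      congr 1
      push_cast; ring
    · simp [indicator_of_notMem hyR]
  refine lt_of_le_of_lt ?_ hint.2
  rw [← lintegral_indicator measurableSet_ball]
  refine lintegral_mono_ae ?_
  have h0 : ∀ᵐ u ∂μ, u ≠ 0 := by simp [ae_iff]
  filter_upwards [h0] with u hu
  by_cases hR : u ∈ Metric.ball (0 : E) R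
  · have hR' : ‖u‖ ∈ Iio R := by simpa using hR
    have hpos : 0 < ‖u‖ := norm_pos_iff.2 hu
    rw [indicator_of_mem hR, indicator_of_mem hR', Real.enorm_of_nonneg (by positivity),
      ← ENNReal.ofReal_rpow_of_pos hpos, ofReal_norm]
  · simp [indicator_of_notMem hR]

/-- Translation by `a` carries the ball of radius `R` into the ball of radius `2 * R`; the point is
that the bound does not depend on `a`. -/
theorem lintegral_ball_enorm_sub_rpow_le {E : Type*} [NormedAddCommGroup E] [NormedSpace ℝ E]
    [FiniteDimensional ℝ E] [MeasurableSpace E] [BorelSpace E] (μ : Measure E)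
    [μ.IsAddHaarMeasure] (b : ℝ) (R : ℝ) {a : E} (ha : ‖a‖ ≤ R) :
    ∫⁻ u in Metric.ball (0 : E) R, ‖u - a‖ₑ ^ (-b) ∂μ
      ≤ ∫⁻ u in Metric.ball (0 : E) (2 * R), ‖u‖ₑ ^ (-b) ∂μ := by
  rw [← lintegral_indicator measurableSet_ball, ← lintegral_indicator measurableSet_ball,
    ← lintegral_sub_right_eq_self
      (fun u => (Metric.ball (0 : E) (2 * R)).indicator (fun u => ‖u‖ₑ ^ (-b)) u) a]
  refine lintegral_mono fun u => ?_
  by_cases hR : u ∈ Metric.ball (0 : E) R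
  · have h2 : u - a ∈ Metric.ball (0 : E) (2 * R) := by
      have : ‖u‖ < R := by simpa using hR
      have := norm_sub_le u a
      rw [mem_ball_zero_iff]; linarith
    rw [indicator_of_mem hR, indicator_of_mem h2]
  · simp [indicator_of_notMem hR]

/-- In polar coordinates the Jacobian is at most `1` on the disk, which leaves a one-dimensional
singularity at `r`. -/
theorem lintegral_disk_enorm_radius_sub_rpow_lt_top {b : ℝ} (hb : b < 1) {r : ℝ}
    (hr0 : 0 ≤ r) (hr : r ≤ 1) :
    ∫⁻ ζ in D, ‖r - ‖ζ‖‖ₑ ^ (-b) < ⊤ := by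
  have hfin : ∫⁻ y in Metric.ball (0 : ℝ) 1, ‖y - r‖ₑ ^ (-b) < ⊤ :=
    (lintegral_ball_enorm_sub_rpow_le volume b 1 (by rwa [Real.norm_of_nonneg hr0])).trans_lt
      (lintegral_ball_enorm_rpow_lt_top volume (by simpa using hb) _)
  rw [D, ← lintegral_indicator measurableSet_ball, ← Complex.lintegral_comp_polarCoord_symm,
    polarCoord_target, Measure.volume_eq_prod, ← Measure.prod_restrict]
  calc _ ≤ ∫⁻ p, (Metric.ball (0 : ℝ) 1).indicator (fun y => ‖y - r‖ₑ ^ (-b)) p.1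
          ∂((volume.restrict (Ioi (0 : ℝ))).prod
            (volume.restrict (Ioo (-Real.pi) Real.pi))) := by
        rw [Measure.prod_restrict]
        refine setLIntegral_mono' (measurableSet_Ioi.prod measurableSet_Ioo) fun p hp => ?_
        have hp0 : 0 < p.1 := hp.1
        have hn : ‖Complex.polarCoord.symm p‖ = p.1 := by
          rw [Complex.norm_polarCoord_symm, abs_of_pos hp0]
        by_cases h1 : p.1 < 1
        · rw [indicator_of_mem (by rwa [mem_ball_zero_iff, hn]),
            indicator_of_mem (by rwa [mem_ball_zero_iff, Real.norm_of_nonneg hp0.le]), hn,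
            smul_eq_mul, enorm_sub_rev]
          refine mul_le_of_le_one_left' ?_
          rw [ENNReal.ofReal_le_one]; exact h1.le
        · rw [indicator_of_notMem (by rwa [mem_ball_zero_iff, hn])]; simp
    _ ≤ ∫⁻ _ in Ioo (-Real.pi) Real.pi, (∫⁻ y in Metric.ball (0 : ℝ) 1, ‖y - r‖ₑ ^ (-b)) := by
        rw [lintegral_prod_symm']
        · refine lintegral_mono fun _ => ?_
          refine (setLIntegral_le_lintegral _ _).trans_eq ?_
          rw [lintegral_indicator measurableSet_ball]
        · exact (Measurable.indicator (by fun_prop) measurableSet_ball).comp measurable_fst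
    _ < ⊤ := by
        rw [setLIntegral_const]
        exact ENNReal.mul_lt_top hfin (by simp)

/-! ### The kernel bound and absolute convergence -/

/-- The squares of the two sides differ by `(1 - |z|²)(1 - |ζ|²)`. -/
theorem norm_sub_le_norm_one_sub_mul_conj {z ζ : ℂ} (hz : ‖z‖ ≤ 1) (hζ : ‖ζ‖ ≤ 1) :
    ‖ζ - z‖ ≤ ‖1 - z * conj ζ‖ := by
  have h1 : ‖z‖ ^ 2 ≤ 1 := pow_le_one₀ (norm_nonneg _) hz
  have h2 : ‖ζ‖ ^ 2 ≤ 1 := pow_le_one₀ (norm_nonneg _) hζ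
  refine le_of_sq_le_sq ?_ (norm_nonneg _)
  have := mul_nonneg (sub_nonneg.2 h1) (sub_nonneg.2 h2)
  rw [← Complex.normSq_eq_norm_sq, Complex.normSq_apply] at *
  rw [← Complex.normSq_eq_norm_sq, Complex.normSq_apply] at *
  simp at *
  nlinarith

theorem enorm_kernel_le (f : ℂ → ℂ) {z ζ : ℂ} (hz : ‖z‖ < 1) (hζ : ‖ζ‖ < 1) :
    ‖kernel f z ζ‖ₑ ≤ 4 * ‖f ζ / ζ‖ₑ * ‖ζ - z‖ₑ⁻¹ := by
  have hconj : conj (f ζ) / conj ζ = conj (f ζ / ζ) := by simp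
  by_cases h0 : f ζ / ζ = 0
  · rw [kernel, hconj, h0]; simp
  by_cases hzζ : ζ - z = 0
  -- On the diagonal the right side is `⊤`, because `f ζ / ζ ≠ 0` here.
  · rw [hzζ]; simp [ENNReal.mul_top, h0]
  have hpos : 0 < ‖ζ - z‖ := norm_pos_iff.2 hzζ
  have hle := norm_sub_le_norm_one_sub_mul_conj hz.le hζ.le
  have h1 : ‖(ζ + z) / (ζ - z)‖ ≤ 2 / ‖ζ - z‖ := by
    rw [norm_div]
    gcongr
    linarith [norm_add_le ζ z]
  have h2 : ‖(1 + z * conj ζ) / (1 - z * conj ζ)‖ ≤ 2 / ‖ζ - z‖ := by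
    rw [norm_div]
    have : ‖z * conj ζ‖ ≤ 1 := by
      rw [norm_mul, RCLike.norm_conj]; exact mul_le_one₀ hz.le (norm_nonneg _) hζ.le
    have h3 : ‖1 + z * conj ζ‖ ≤ 2 := by
      refine (norm_add_le _ _).trans ?_
      rw [norm_one]; linarith
    gcongr
  have h3 : ‖kernel f z ζ‖ ≤ 4 * ‖f ζ / ζ‖ * ‖ζ - z‖⁻¹ := by
    rw [kernel, hconj]
    refine (norm_add_le _ _).trans ?_
    rw [norm_mul, norm_mul, RCLike.norm_conj]
    calc _ ≤ ‖f ζ / ζ‖ * (2 / ‖ζ - z‖) + ‖f ζ / ζ‖ * (2 / ‖ζ - z‖) := by gcongr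
      _ = _ := by ring
  calc ‖kernel f z ζ‖ₑ = ENNReal.ofReal ‖kernel f z ζ‖ := (ofReal_norm _).symm
    _ ≤ ENNReal.ofReal (4 * ‖f ζ / ζ‖ * ‖ζ - z‖⁻¹) := ENNReal.ofReal_le_ofReal h3
    _ = _ := by
      rw [ENNReal.ofReal_mul (by positivity), ENNReal.ofReal_mul (by positivity),
        ENNReal.ofReal_inv_of_pos hpos, ofReal_norm, ofReal_norm]
      norm_num

theorem measurableSet_D : MeasurableSet D := measurableSet_ball

theorem mem_D {z : ℂ} : z ∈ D ↔ ‖z‖ < 1 := mem_ball_zero_iff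

theorem aestronglyMeasurable_kernel {f : ℂ → ℂ} (hf : IntegrableOn f D) {X : Type*}
    [MeasurableSpace X] {μ : Measure X} [SFinite μ] {g : X → ℂ} (hg : Measurable g) :
    AEStronglyMeasurable (fun p : ℂ × X => kernel f (g p.2) p.1)
      ((volume.restrict D).prod μ) := by
  have h1 : AEStronglyMeasurable (fun p : ℂ × X => f p.1) ((volume.restrict D).prod μ) :=
    hf.aestronglyMeasurable.comp_fst
  have h2 : AEStronglyMeasurable (fun p : ℂ × X => conj (f p.1)) ((volume.restrict D).prod μ) :=
    Complex.continuous_conj.comp_aestronglyMeasurable h1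
  have hm : Measurable fun z : ℂ => conj z := Complex.continuous_conj.measurable
  have hm1 : Measurable fun p : ℂ × X => conj p.1 := hm.comp measurable_fst
  have hg1 : Measurable fun p : ℂ × X => g p.2 := hg.comp measurable_snd
  unfold kernel
  simp only [div_eq_mul_inv]
  have m1 : Measurable fun p : ℂ × X => (p.1)⁻¹ := measurable_fst.inv
  have m2 : Measurable fun p : ℂ × X => (p.1 + g p.2) * (p.1 - g p.2)⁻¹ := by fun_prop
  have m3 : Measurable fun p : ℂ × X => (conj p.1)⁻¹ := hm1.inv
  have m4 : Measurable fun p : ℂ × X => (1 + g p.2 * conj p.1) * (1 - g p.2 * conj p.1)⁻¹ := by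
    fun_prop
  exact ((h1.mul m1.aestronglyMeasurable).mul m2.aestronglyMeasurable).add
    ((h2.mul m3.aestronglyMeasurable).mul m4.aestronglyMeasurable)

theorem lintegral_disk_enorm_sub_inv_le {ζ : ℂ} (hζ : ‖ζ‖ ≤ 1) :
    ∫⁻ z in D, ‖ζ - z‖ₑ⁻¹ ≤ ∫⁻ u in Metric.ball (0 : ℂ) 2, ‖u‖ₑ⁻¹ := by
  have := lintegral_ball_enorm_sub_rpow_le volume 1 1 hζ
  simpa only [D, ENNReal.rpow_neg_one, mul_one, enorm_sub_rev _ ζ] using this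

theorem lintegral_ball_enorm_inv_lt_top : ∫⁻ u in Metric.ball (0 : ℂ) 2, ‖u‖ₑ⁻¹ < ⊤ := by
  have := lintegral_ball_enorm_rpow_lt_top (E := ℂ) volume (b := 1)
    (by rw [Complex.finrank_real_complex]; norm_num) 2
  simpa only [ENNReal.rpow_neg_one] using this

theorem integrable_kernel_prod {f : ℂ → ℂ} (hf : IntegrableOn f D)
    (hf0 : IntegrableOn (fun ζ : ℂ => f ζ / ζ) D) :
    Integrable (fun p : ℂ × ℂ => kernel f p.2 p.1)
      ((volume.restrict D).prod (volume.restrict D)) := by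
  have hm := aestronglyMeasurable_kernel hf (μ := volume.restrict D) (g := fun z => z)
    measurable_id
  refine ⟨hm, ?_⟩
  rw [HasFiniteIntegral, lintegral_prod _ hm.enorm]
  calc _ ≤ ∫⁻ ζ in D, 4 * ‖f ζ / ζ‖ₑ * ∫⁻ u in Metric.ball (0 : ℂ) 2, ‖u‖ₑ⁻¹ := by
        refine setLIntegral_mono' measurableSet_D fun ζ hζ => ?_
        refine le_trans (b := 4 * ‖f ζ / ζ‖ₑ * ∫⁻ z in D, ‖ζ - z‖ₑ⁻¹) ?_
          (mul_le_mul_right (lintegral_disk_enorm_sub_inv_le (mem_D.1 hζ).le) _)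
        rw [← lintegral_const_mul _ (by fun_prop)]
        exact setLIntegral_mono' measurableSet_D fun z hz =>
          enorm_kernel_le f (mem_D.1 hz) (mem_D.1 hζ)
    _ < ⊤ := by
        rw [lintegral_mul_const'' _ (hf0.aestronglyMeasurable.enorm.const_mul _),
          lintegral_const_mul'' _ hf0.aestronglyMeasurable.enorm]
        exact ENNReal.mul_lt_top (ENNReal.mul_lt_top (by norm_num) hf0.2)
          lintegral_ball_enorm_inv_lt_top

theorem integrableOn_kernel_ae {f : ℂ → ℂ} (hf : IntegrableOn f D)
    (hf0 : IntegrableOn (fun ζ : ℂ => f ζ / ζ) D) :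
    ∀ᵐ z ∂(volume.restrict D), IntegrableOn (kernel f z) D :=
  (integrable_kernel_prod hf hf0).prod_left_ae

theorem kernel_zero (f : ℂ → ℂ) (ζ : ℂ) : kernel f 0 ζ = f ζ / ζ + conj (f ζ / ζ) := by
  by_cases h : ζ = 0
  · simp [kernel, h]
  · simp [kernel, h]

theorem integrableOn_kernel_zero {f : ℂ → ℂ}
    (hf0 : IntegrableOn (fun ζ : ℂ => f ζ / ζ) D) : IntegrableOn (kernel f 0) D := by
  have h : kernel f 0 = fun ζ => f ζ / ζ + conj (f ζ / ζ) := funext (kernel_zero f)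
  rw [h]
  exact hf0.add (Complex.conjCLE.toContinuousLinearMap.integrable_comp hf0)

/-! ### Admissible radii -/

theorem rpow_le_rpow_of_exponent_nonpos {x y : ℝ≥0∞} {b : ℝ} (hb : b ≤ 0) (h : x ≤ y) :
    y ^ b ≤ x ^ b := by
  rw [← neg_neg b, ENNReal.rpow_neg y, ENNReal.rpow_neg x, ENNReal.inv_le_inv]
  exact ENNReal.rpow_le_rpow h (neg_nonneg.2 hb)

/-- The chord has length `2 |sin (u / 2)|`, so this is Jordan's inequality. -/
theorem abs_le_norm_circleMap_sub {t u : ℝ} (hu : |u| ≤ Real.pi) :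
    2 / Real.pi * |u| ≤ ‖circleMap 0 1 (t + u) - circleMap 0 1 t‖ := by
  have h : circleMap 0 1 (t + u) - circleMap 0 1 t
      = circleMap 0 1 t * (Complex.exp (Complex.I * u) - 1) := by
    simp only [circleMap]
    push_cast
    rw [add_mul, Complex.exp_add, mul_comm Complex.I]
    ring
  rw [h, norm_mul, norm_circleMap_zero, Complex.norm_exp_I_mul_ofReal_sub_one, norm_mul]
  have h2 : |u / 2| ≤ Real.pi / 2 := by
    rw [abs_div, abs_two]; linarith
  have := Real.mul_abs_le_abs_sin h2
  rw [abs_div, abs_two] at this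
  simp only [Real.norm_eq_abs, abs_one, abs_two]
  linarith

/-- Moving `ζ` radially onto the circle of radius `r` costs `||ζ| - r|`, itself at most the distance
on the right; hence the factor `1 / 2`. The convention for `arg 0` is harmless, since that direction
is multiplied by `|ζ| = 0`. -/
theorem norm_circleMap_one_sub_le {r : ℝ} (hr : 0 < r) (θ : ℝ) (ζ : ℂ) :
    r / 2 * ‖circleMap 0 1 θ - circleMap 0 1 ζ.arg‖ ≤ ‖ζ - circleMap 0 r θ‖ := by
  have e1 : ∀ s φ : ℝ, circleMap 0 s φ = s * circleMap 0 1 φ := by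
    intro s φ; simp [circleMap]
  have e2 : ζ = ‖ζ‖ * circleMap 0 1 ζ.arg := by
    simp [circleMap]
  have h1 : |‖ζ‖ - r| ≤ ‖ζ - circleMap 0 r θ‖ := by
    have := abs_norm_sub_norm_le ζ (circleMap 0 r θ)
    rwa [norm_circleMap_zero, abs_of_pos hr] at this
  have h2 : (r : ℂ) * (circleMap 0 1 θ - circleMap 0 1 ζ.arg)
      = -(ζ - circleMap 0 r θ) + ((‖ζ‖ - r : ℝ) : ℂ) * circleMap 0 1 ζ.arg := by
    conv_rhs => rw [e1 r θ]; enter [1, 1, 1]; rw [e2]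
    push_cast; ring
  have h3 : r * ‖circleMap 0 1 θ - circleMap 0 1 ζ.arg‖
      ≤ ‖ζ - circleMap 0 r θ‖ + |‖ζ‖ - r| := by
    have := congrArg norm h2
    rw [norm_mul, Complex.norm_real, Real.norm_of_nonneg hr.le] at this
    rw [this]
    refine (norm_add_le _ _).trans_eq ?_
    rw [norm_neg, norm_mul, Complex.norm_real, norm_circleMap_zero]
    simp
  linarith

theorem lintegral_Ioc_eq_of_periodic {F : ℝ → ℝ≥0∞} (hF : Function.Periodic F (2 * Real.pi))
    (a b : ℝ) :
    ∫⁻ θ in Ioc a (a + 2 * Real.pi), F θ = ∫⁻ θ in Ioc b (b + 2 * Real.pi), F θ :=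
  (isAddFundamentalDomain_Ioc Real.two_pi_pos a).setLIntegral_eq
    (isAddFundamentalDomain_Ioc Real.two_pi_pos b) F hF.map_vadd_zmultiples

theorem lintegral_enorm_circleMap_sub_rpow_le {b : ℝ} (hb : 0 ≤ b) (t : ℝ) :
    ∫⁻ θ in Ioc 0 (2 * Real.pi), ‖circleMap 0 1 θ - circleMap 0 1 t‖ₑ ^ (-b)
      ≤ ENNReal.ofReal (2 / Real.pi) ^ (-b) *
        ∫⁻ u in Metric.ball (0 : ℝ) 4, ‖u‖ₑ ^ (-b) := by
  have hper : Function.Periodic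
      (fun θ => ‖circleMap 0 1 θ - circleMap 0 1 t‖ₑ ^ (-b)) (2 * Real.pi) := fun θ => by
    simp only [periodic_circleMap 0 1 θ]
  -- Centring the period at `t` makes the angular difference at most `π < 4`, so the chord estimate
  -- applies and the ball of radius `4` suffices.
  have h := lintegral_Ioc_eq_of_periodic hper 0 (t - Real.pi)
  rw [zero_add] at h
  have hpi := Real.pi_pos
  rw [h, ← lintegral_indicator measurableSet_Ioc,
    ← lintegral_const_mul' _ _ (by
      refine ENNReal.rpow_ne_top_of_ne_zero ?_ ENNReal.ofReal_ne_top
      rw [ne_eq, ENNReal.ofReal_eq_zero, not_le]; positivity),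
    ← lintegral_indicator measurableSet_ball,
    ← lintegral_sub_right_eq_self
      (fun u => (Metric.ball (0 : ℝ) 4).indicator (fun u => ENNReal.ofReal (2 / Real.pi) ^ (-b) *
        ‖u‖ₑ ^ (-b)) u) t]
  refine lintegral_mono fun θ => ?_
  by_cases hθ : θ ∈ Ioc (t - Real.pi) (t - Real.pi + 2 * Real.pi)
  · have hu : |θ - t| ≤ Real.pi := abs_le.2 ⟨by linarith [hθ.1], by linarith [hθ.2]⟩
    have hm : θ - t ∈ Metric.ball (0 : ℝ) 4 := by
      rw [mem_ball_zero_iff, Real.norm_eq_abs]; exact hu.trans_lt Real.pi_lt_four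
    rw [indicator_of_mem hθ, indicator_of_mem hm]
    rcases eq_or_lt_of_le hb with rfl | hb'
    · simp
    rw [← ENNReal.mul_rpow_of_ne_top ENNReal.ofReal_ne_top enorm_ne_top]
    refine rpow_le_rpow_of_exponent_nonpos (by linarith) ?_
    have := abs_le_norm_circleMap_sub (t := t) hu
    rw [add_sub_cancel] at this
    rw [← ofReal_norm, ← ofReal_norm, ← ENNReal.ofReal_mul (by positivity)]
    exact ENNReal.ofReal_le_ofReal this
  · simp [indicator_of_notMem hθ]

theorem enorm_inv_le_rpow_mul_rpow {a : ℝ} (ha0 : 0 ≤ a) (ha1 : a ≤ 1) {x y w : ℝ≥0∞}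
    (hx : x ≤ w) (hy : y ≤ w) : w⁻¹ ≤ x ^ (-a) * y ^ (-(1 - a)) := by
  rcases eq_or_ne w 0 with rfl | hw
  · obtain rfl : x = 0 := by simpa using hx
    obtain rfl : y = 0 := by simpa using hy
    rcases eq_or_lt_of_le ha0 with rfl | h0
    · simp
    · rcases eq_or_lt_of_le ha1 with rfl | h1
      · simp
      · rw [ENNReal.zero_rpow_of_neg (by linarith), ENNReal.zero_rpow_of_neg (by linarith)]
        simp
  rcases eq_or_ne w ⊤ with rfl | hw'
  · simp
  calc w⁻¹ = w ^ (-a) * w ^ (-(1 - a)) := by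
        rw [← ENNReal.rpow_add _ _ hw hw', ← ENNReal.rpow_neg_one]; congr 1; ring
    _ ≤ _ := mul_le_mul' (rpow_le_rpow_of_exponent_nonpos (by linarith) hx)
        (rpow_le_rpow_of_exponent_nonpos (by linarith) hy)

/-- The distance dominates both its radial part and, up to `r / 2`, its angular part. Giving them
the exponents `-a` and `-(1 - a)` leaves an angular singularity of order below `1`, with a constant
independent of `r` and `ζ`. -/
theorem exists_lintegral_circle_enorm_sub_inv_le {a : ℝ} (ha0 : 0 < a) (ha1 : a ≤ 1) :
    ∃ C : ℝ≥0∞, C ≠ ⊤ ∧ ∀ r : ℝ, 0 < r → ∀ ζ : ℂ,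
      ∫⁻ θ in Ioc 0 (2 * Real.pi), ‖ζ - circleMap 0 r θ‖ₑ⁻¹
        ≤ C * ENNReal.ofReal (r / 2) ^ (-(1 - a)) * ‖r - ‖ζ‖‖ₑ ^ (-a) := by
  refine ⟨ENNReal.ofReal (2 / Real.pi) ^ (-(1 - a)) *
        ∫⁻ u in Metric.ball (0 : ℝ) 4, ‖u‖ₑ ^ (-(1 - a)), ?_, fun r hr ζ => ?_⟩
  · refine ENNReal.mul_ne_top (ENNReal.rpow_ne_top_of_ne_zero ?_ ENNReal.ofReal_ne_top)
      (lintegral_ball_enorm_rpow_lt_top volume (by simpa using ha0) _).ne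
    have := Real.pi_pos
    rw [ne_eq, ENNReal.ofReal_eq_zero, not_le]; positivity
  have hpos : ENNReal.ofReal (r / 2) ≠ 0 := by
    rw [ne_eq, ENNReal.ofReal_eq_zero, not_le]; positivity
  calc _ ≤ ∫⁻ θ in Ioc 0 (2 * Real.pi), ‖r - ‖ζ‖‖ₑ ^ (-a) * ENNReal.ofReal (r / 2) ^ (-(1 - a)) *
          ‖circleMap 0 1 θ - circleMap 0 1 ζ.arg‖ₑ ^ (-(1 - a)) := by
        refine lintegral_mono fun θ => ?_
        rw [mul_assoc, ← ENNReal.mul_rpow_of_ne_top ENNReal.ofReal_ne_top enorm_ne_top]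
        refine enorm_inv_le_rpow_mul_rpow ha0.le ha1 ?_ ?_
        · rw [← ofReal_norm, ← ofReal_norm]
          refine ENNReal.ofReal_le_ofReal ?_
          have := abs_norm_sub_norm_le ζ (circleMap 0 r θ)
          rwa [norm_circleMap_zero, abs_of_pos hr, abs_sub_comm] at this
        · rw [← ofReal_norm, ← ofReal_norm, ← ENNReal.ofReal_mul (by positivity)]
          exact ENNReal.ofReal_le_ofReal (norm_circleMap_one_sub_le hr θ ζ)
    _ = ‖r - ‖ζ‖‖ₑ ^ (-a) * ENNReal.ofReal (r / 2) ^ (-(1 - a)) *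
          ∫⁻ θ in Ioc 0 (2 * Real.pi),
            ‖circleMap 0 1 θ - circleMap 0 1 ζ.arg‖ₑ ^ (-(1 - a)) := by
        rw [lintegral_const_mul]
        have := (continuous_circleMap 0 1).measurable
        fun_prop
    _ ≤ _ := by
        refine (mul_le_mul_right (lintegral_enorm_circleMap_sub_rpow_le (by linarith) _) _).trans_eq ?_
        ring

theorem mem_admissibleRadii_of_lintegral {f : ℂ → ℂ} (hf : IntegrableOn f D) {r : ℝ}
    (hr : r ∈ Ioo (0 : ℝ) 1) {a : ℝ} (ha0 : 0 < a) (ha1 : a ≤ 1)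
    (h : ∫⁻ ζ in D, ‖f ζ / ζ‖ₑ * ‖r - ‖ζ‖‖ₑ ^ (-a) < ⊤) : r ∈ admissibleRadii f := by
  have hm := aestronglyMeasurable_kernel hf (μ := volume.restrict (Ioc 0 (2 * Real.pi)))
    (continuous_circleMap 0 r).measurable
  refine ⟨hr, hm, ?_⟩
  obtain ⟨C, hC, hbound⟩ := exists_lintegral_circle_enorm_sub_inv_le ha0 ha1
  set K : ℝ≥0∞ := C * ENNReal.ofReal (r / 2) ^ (-(1 - a)) with hK
  have hKtop : K ≠ ⊤ := by
    refine ENNReal.mul_ne_top hC (ENNReal.rpow_ne_top_of_ne_zero ?_ ENNReal.ofReal_ne_top)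
    rw [ne_eq, ENNReal.ofReal_eq_zero, not_le]; linarith [hr.1]
  rw [HasFiniteIntegral, lintegral_prod _ hm.enorm]
  have hmc := (continuous_circleMap 0 r).measurable
  calc _ ≤ ∫⁻ ζ in D, 4 * K * (‖f ζ / ζ‖ₑ * ‖r - ‖ζ‖‖ₑ ^ (-a)) := by
        refine setLIntegral_mono' measurableSet_D fun ζ hζ => ?_
        calc _ ≤ ∫⁻ θ in Ioc 0 (2 * Real.pi), 4 * ‖f ζ / ζ‖ₑ * ‖ζ - circleMap 0 r θ‖ₑ⁻¹ := by
              refine lintegral_mono fun θ => enorm_kernel_le f ?_ (mem_D.1 hζ)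
              rw [norm_circleMap_zero, abs_of_pos hr.1]; exact hr.2
          _ = 4 * ‖f ζ / ζ‖ₑ * ∫⁻ θ in Ioc 0 (2 * Real.pi), ‖ζ - circleMap 0 r θ‖ₑ⁻¹ := by
              rw [lintegral_const_mul]; fun_prop
          _ ≤ 4 * ‖f ζ / ζ‖ₑ * (K * ‖r - ‖ζ‖‖ₑ ^ (-a)) := mul_le_mul_right (hbound r hr.1 ζ) _
          _ = _ := by ring
    _ < ⊤ := by
        rw [lintegral_const_mul' _ _ (ENNReal.mul_ne_top (by norm_num) hKtop)]
        exact ENNReal.mul_lt_top (ENNReal.mul_lt_top (by norm_num) hKtop.lt_top) h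

/-- With `a = 1 / 2` the weight `|r - |ζ||^(-a)` has an integral over `r` bounded uniformly in `ζ`,
so Tonelli makes the criterion hold for almost every `r`. -/
theorem ae_mem_admissibleRadii {f : ℂ → ℂ} (hf : IntegrableOn f D)
    (hf0 : IntegrableOn (fun ζ : ℂ => f ζ / ζ) D) :
    ∀ᵐ r ∂(volume.restrict (Ioo (0 : ℝ) 1)), r ∈ admissibleRadii f := by
  have hm : AEMeasurable (fun p : ℝ × ℂ => ‖f p.2 / p.2‖ₑ * ‖p.1 - ‖p.2‖‖ₑ ^ (-(1 / 2) : ℝ))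
      ((volume.restrict (Ioo (0 : ℝ) 1)).prod (volume.restrict D)) := by
    have h1 : AEMeasurable (fun p : ℝ × ℂ => ‖f p.2 / p.2‖ₑ)
        ((volume.restrict (Ioo (0 : ℝ) 1)).prod (volume.restrict D)) :=
      (hf0.aestronglyMeasurable.comp_snd).enorm
    exact h1.mul (by fun_prop)
  have hfin : ∫⁻ r in Ioo (0 : ℝ) 1, ∫⁻ ζ in D, ‖f ζ / ζ‖ₑ * ‖r - ‖ζ‖‖ₑ ^ (-(1 / 2) : ℝ) < ⊤ := by
    rw [lintegral_lintegral_swap hm]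
    have hb := lintegral_ball_enorm_rpow_lt_top (E := ℝ) volume (b := 1 / 2)
      (by norm_num) (2 * 1)
    calc _ ≤ ∫⁻ ζ in D, ‖f ζ / ζ‖ₑ *
            ∫⁻ u in Metric.ball (0 : ℝ) (2 * 1), ‖u‖ₑ ^ (-(1 / 2) : ℝ) := by
          refine setLIntegral_mono' measurableSet_D fun ζ hζ => ?_
          rw [lintegral_const_mul _ (by fun_prop)]
          refine mul_le_mul_right ?_ _
          refine (lintegral_mono_set fun r hr => ?_).trans (lintegral_ball_enorm_sub_rpow_le volume
            (1 / 2) 1 (a := ‖ζ‖) (by rw [norm_norm]; exact (mem_D.1 hζ).le))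
          rw [mem_ball_zero_iff, Real.norm_eq_abs, abs_of_pos hr.1]
          exact hr.2
      _ < ⊤ := by
          rw [lintegral_mul_const'' _ hf0.aestronglyMeasurable.enorm]
          exact ENNReal.mul_lt_top hf0.2 hb
  have hae := ae_lt_top' hm.lintegral_prod_right' hfin.ne
  filter_upwards [hae, ae_restrict_mem measurableSet_Ioo] with r hr hr1
  exact mem_admissibleRadii_of_lintegral hf hr1 (a := 1 / 2) (by norm_num) (by norm_num) hr

theorem admissibleRadii_eq_of_memLp {f : ℂ → ℂ} (hf : IntegrableOn f D)
    (hf0 : IntegrableOn (fun ζ : ℂ => f ζ / ζ) D) {q : ℝ≥0∞} (hq : 1 < q)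
    (hfq : MemLp f q (volume.restrict D)) : admissibleRadii f = Ioo 0 1 := by
  refine Subset.antisymm (fun r hr => hr.1) fun r hr => ?_
  have : IsFiniteMeasure (volume.restrict D) :=
    ⟨by rw [Measure.restrict_apply_univ]; exact measure_ball_lt_top⟩
  obtain ⟨s, hs1, hsq, hs⟩ : ∃ s : ℝ, 1 < s ∧ s ≤ 2 ∧ MemLp f (ENNReal.ofReal s)
      (volume.restrict D) := by
    -- Capping at `2` gives a finite real exponent even for `q = ⊤`; on the finite-measure disk,
    -- lowering the exponent is free.
    refine ⟨(min q 2).toReal, ?_, ?_, ?_⟩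
    · rw [← ENNReal.toReal_one]
      exact ENNReal.toReal_strict_mono (by simp) (lt_min hq (by norm_num))
    · exact ENNReal.toReal_le_of_le_ofReal (by norm_num) (by simp)
    · rw [ENNReal.ofReal_toReal (by simp)]
      exact hfq.mono_exponent (min_le_left _ _)
  have hp : s.HolderConjugate (s.conjExponent) := Real.HolderConjugate.conjExponent hs1
  set p := s.conjExponent
  have hp1 : 1 < p := hp.symm.lt
  have hp0 : 0 < p := by linarith
  -- Chosen so that `a * p = 1 / 2`: the `p`-th power of the weight is still integrable over the
  -- disk.
  set a : ℝ := 1 / (2 * p) with ha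
  have ha0 : 0 < a := by positivity
  have ha1 : a ≤ 1 := by
    rw [ha, div_le_one (by positivity)]; linarith
  refine mem_admissibleRadii_of_lintegral hf hr ha0 ha1 ?_
  have hr0 := hr.1
  have hr2 : ENNReal.ofReal (r / 2) ≠ 0 := by
    rw [ne_eq, ENNReal.ofReal_eq_zero, not_le]; positivity
  have hc1 : ENNReal.ofReal (r / 2) ^ (-a) ≠ ⊤ :=
    ENNReal.rpow_ne_top_of_ne_zero hr2 ENNReal.ofReal_ne_top
  have hc2 : (ENNReal.ofReal (r / 2))⁻¹ ≠ ⊤ := ENNReal.inv_ne_top.2 hr2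
  -- Split at `|ζ| = r / 2`: inside, the weight is bounded and `f ζ / ζ` is integrable; outside,
  -- division by `ζ` costs at most `2 / r`, so Hölder can be applied to `f` itself.
  have hbound : ∀ ζ, ‖f ζ / ζ‖ₑ * ‖r - ‖ζ‖‖ₑ ^ (-a)
      ≤ ENNReal.ofReal (r / 2) ^ (-a) * ‖f ζ / ζ‖ₑ
        + (ENNReal.ofReal (r / 2))⁻¹ * (‖f ζ‖ₑ * ‖r - ‖ζ‖‖ₑ ^ (-a)) := by
    intro ζ
    rcases le_or_gt ‖ζ‖ (r / 2) with h | h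
    · refine le_trans ?_ le_self_add
      rw [mul_comm]
      refine mul_le_mul_left (rpow_le_rpow_of_exponent_nonpos (by linarith) ?_) _
      rw [← ofReal_norm, Real.norm_eq_abs]
      exact ENNReal.ofReal_le_ofReal (by rw [abs_of_nonneg] <;> linarith)
    · refine le_trans ?_ le_add_self
      rw [← mul_assoc]
      refine mul_le_mul_left ?_ _
      have hζ : ζ ≠ 0 := by
        rintro rfl; rw [norm_zero] at h; linarith
      rw [div_eq_mul_inv, enorm_mul, enorm_inv hζ, mul_comm, ← ofReal_norm ζ]
      gcongr
  refine (lintegral_mono hbound).trans_lt ?_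
  rw [lintegral_add_left' (hf0.aestronglyMeasurable.enorm.const_mul _),
    lintegral_const_mul' _ _ hc1, lintegral_const_mul' _ _ hc2]
  refine ENNReal.add_lt_top.2 ⟨ENNReal.mul_lt_top hc1.lt_top hf0.2,
    ENNReal.mul_lt_top hc2.lt_top ?_⟩
  refine (ENNReal.lintegral_mul_le_Lp_mul_Lq _ hp hf.aestronglyMeasurable.enorm
    (by fun_prop)).trans_lt ?_
  refine ENNReal.mul_lt_top (ENNReal.rpow_lt_top_of_nonneg (by positivity) ?_)
    (ENNReal.rpow_lt_top_of_nonneg (by positivity) ?_)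
  · have := lintegral_rpow_enorm_lt_top_of_eLpNorm_lt_top (by simpa using (by linarith : 0 < s))
      ENNReal.ofReal_ne_top hs.2
    rw [ENNReal.toReal_ofReal (by linarith)] at this
    exact this.ne
  · have e : ∀ ζ : ℂ, (‖r - ‖ζ‖‖ₑ ^ (-a)) ^ p = ‖r - ‖ζ‖‖ₑ ^ (-(1 / 2) : ℝ) := by
      intro ζ
      rw [← ENNReal.rpow_mul]; congr 1; rw [ha]; field_simp
    simp only [e]
    exact (lintegral_disk_enorm_radius_sub_rpow_lt_top (by norm_num) hr0.le hr.2.le).ne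

/-! ### Poisson representation of `h` and reduction to `𝒯_D(f)` -/

theorem poissonKernel_circleMap (w : ℂ) (t : ℝ) :
    poissonKernel 0 w (circleMap 0 1 t) = poisson ‖w‖ (w.arg - t) := by
  have hw : w = ‖w‖ * (Real.cos w.arg + Real.sin w.arg * Complex.I) := by
    push_cast; exact (Complex.norm_mul_cos_add_sin_mul_I w).symm
  have hc : circleMap 0 1 t = Real.cos t + Real.sin t * Complex.I := by
    simp [circleMap, Complex.exp_mul_I]
  have hd : ‖circleMap 0 1 t - w‖ ^ 2 = 1 - 2 * ‖w‖ * Real.cos (w.arg - t) + ‖w‖ ^ 2 := by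
    generalize ‖w‖ = r at hw ⊢
    generalize w.arg = s at hw ⊢
    rw [← Complex.normSq_eq_norm_sq, Complex.normSq_apply, hc, hw, Real.cos_sub]
    simp only [Complex.sub_re, Complex.sub_im, Complex.add_re, Complex.add_im, Complex.mul_re,
      Complex.mul_im, Complex.ofReal_re, Complex.ofReal_im, Complex.I_re, Complex.I_im]
    linear_combination Real.sin_sq_add_cos_sq t + r ^ 2 * Real.sin_sq_add_cos_sq s
  rw [poissonKernel_def, poisson, sub_zero, sub_zero, hd, norm_circleMap_zero]
  simp

theorem boundaryValue_poissonTest {h : ℂ → ℂ} {hb : CircleTest → ℂ}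
    (hh : DifferentiableOn ℂ h D) (hbv : HasBoundaryValue (Ioo 0 1) h hb) (z : ℂ) (hz : ‖z‖ < 1) :
    hb (poissonTest z hz) = 2 * Real.pi * h z := by
  have hset : Ioo (0 : ℝ) 1 ∩ Iio 1 = Ioo 0 1 := inter_eq_left.2 fun r hr => hr.2
  have hlim := hbv.2 (poissonTest z hz)
  rw [hset] at hlim
  have : (𝓝[Ioo (0 : ℝ) 1] 1).NeBot := by
    rw [nhdsWithin_Ioo_eq_nhdsLT one_pos]; infer_instance
  -- For `ρ < 1` the dilation of `h` by `ρ` is holomorphic on the closed disk, so the pairing equals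
  -- `2π h (ρ z)`; the limit follows from continuity of `h` at `z`.
  refine tendsto_nhds_unique (hlim.congr' (f₂ := fun ρ : ℝ => 2 * Real.pi * h (ρ * z)) ?_) ?_
  · filter_upwards [self_mem_nhdsWithin] with ρ hρ
    have hmaps : ∀ x : ℂ, ‖x‖ ≤ 1 → (ρ : ℂ) * x ∈ D := fun x hx => by
      rw [mem_D, norm_mul, Complex.norm_real, Real.norm_of_nonneg hρ.1.le]
      calc ρ * ‖x‖ ≤ ρ * 1 := by gcongr; exact hρ.1.le
        _ < 1 := by rw [mul_one]; exact hρ.2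
    have hdc : DiffContOnCl ℂ (fun x : ℂ => h (ρ * x)) (Metric.ball 0 1) := by
      refine DifferentiableOn.diffContOnCl ?_
      rw [closure_ball _ one_ne_zero]
      exact hh.comp (by fun_prop) fun x hx => hmaps x (by simpa using hx)
    have := hdc.circleAverage_poissonKernel_smul (w := z) (by simpa using hz)
    rw [Real.circleAverage_def] at this
    rw [← this, Complex.real_smul]
    push_cast
    rw [mul_inv_cancel_left₀ (by simp [Real.pi_ne_zero])]
    refine intervalIntegral.integral_congr fun t _ => ?_
    simp only [Pi.smul_apply', poissonKernel_circleMap, poissonTest, Complex.real_smul]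
    rw [mul_comm]
    congr 2
    simp [circleMap]
  · have hc : ContinuousAt h ((1 : ℝ) * z) := by
      have : z ∈ D := mem_D.2 hz
      rw [Complex.ofReal_one, one_mul]
      exact (hh.differentiableAt (Metric.isOpen_ball.mem_nhds this)).continuousAt
    have hc2 : ContinuousAt (fun ρ : ℝ => h (ρ * z)) 1 :=
      ContinuousAt.comp (f := fun ρ : ℝ => (ρ : ℂ) * z) hc (by fun_prop)
    have := (hc2.tendsto.const_mul (2 * Real.pi : ℂ)).mono_left
      (nhdsWithin_le_nhds (s := Ioo (0 : ℝ) 1))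
    simpa using this

theorem boundaryValue_oneTest {h : ℂ → ℂ} {hb : CircleTest → ℂ}
    (hh : DifferentiableOn ℂ h D) (hbv : HasBoundaryValue (Ioo 0 1) h hb) :
    hb oneTest = 2 * Real.pi * h 0 := by
  -- The Poisson kernel of radius `0` is the constant `1`.
  rw [← boundaryValue_poissonTest hh hbv 0 (by simp)]
  congr 1
  refine Subtype.ext (funext fun t => ?_)
  simp [oneTest, poissonTest, poisson]

theorem imPart_oneTest (T : CircleTest → ℂ) : imPart T oneTest = (T oneTest).im := by
  have : conjTest oneTest = oneTest := Subtype.ext (funext fun t => by simp [conjTest, oneTest])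
  rw [imPart, this, Complex.sub_conj]
  push_cast
  field_simp

theorem schwarzSolution_eq {f h : ℂ → ℂ} {hb : CircleTest → ℂ} (c : ℝ)
    (hh : DifferentiableOn ℂ h D) (hbv : HasBoundaryValue (Ioo 0 1) h hb) {z : ℂ} (hz : z ∈ D) :
    schwarzSolution f hb c z = Complex.I * ((c - (h 0).im : ℝ) : ℂ) + h z + opT f z := by
  have hpi : (Real.pi : ℂ) ≠ 0 := by simp [Real.pi_ne_zero]
  rw [schwarzSolution, dif_pos (mem_D.1 hz), boundaryValue_poissonTest hh hbv, imPart_oneTest,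
    boundaryValue_oneTest hh hbv]
  have : (2 * (Real.pi : ℂ) * h 0).im = 2 * Real.pi * (h 0).im := by
    rw [← Complex.ofReal_ofNat, ← Complex.ofReal_mul, Complex.im_ofReal_mul]
  rw [this]
  push_cast
  field_simp

theorem opT_zero_im (f : ℂ → ℂ) : (opT f 0).im = 0 := by
  have h : ∀ ζ, kernel f 0 ζ = ((2 * (f ζ / ζ).re : ℝ) : ℂ) := fun ζ => by
    rw [kernel_zero, Complex.add_conj]
  rw [opT]
  simp_rw [h]
  rw [integral_complex_ofReal, ← Complex.ofReal_ofNat, ← Complex.ofReal_one, ← Complex.ofReal_mul,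
    ← Complex.ofReal_div, ← Complex.ofReal_neg, ← Complex.ofReal_mul, Complex.ofReal_im]

theorem schwarzSolution_zero_im {f h : ℂ → ℂ} {hb : CircleTest → ℂ} (c : ℝ)
    (hh : DifferentiableOn ℂ h D) (hbv : HasBoundaryValue (Ioo 0 1) h hb) :
    (schwarzSolution f hb c 0).im = c := by
  rw [schwarzSolution_eq c hh hbv (mem_D.2 (by simp)), Complex.add_im, Complex.add_im, opT_zero_im,
    Complex.I_mul_im, Complex.ofReal_re]
  ring

/-! ### Integration by parts for `∂/∂z̄` -/

theorem integral_fderiv_apply_eq_zero {ψ : ℂ → ℂ} (hψ : ContDiff ℝ 1 ψ)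
    (hc : HasCompactSupport ψ) (v : ℂ) : ∫ z, fderiv ℝ ψ z v = 0 := by
  have hcont : Continuous fun z => fderiv ℝ ψ z v :=
    (hψ.continuous_fderiv one_ne_zero).clm_apply continuous_const
  -- Integration by parts against the constant `1`; only the products need to be integrable.
  have := integral_mul_fderiv_eq_neg_fderiv_mul_of_integrable (μ := (volume : Measure ℂ)) (𝕜 := ℂ)
    (f := fun _ : ℂ => (1 : ℂ)) (g := ψ) (v := v) (by simp)
    (by simpa using hcont.integrable_of_hasCompactSupport (hc.fderiv_apply ℝ v))
    (by simpa using hψ.continuous.integrable_of_hasCompactSupport hc)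
    (fun x _ => differentiableAt_const _) (fun x _ => hψ.differentiable one_ne_zero x)
  simpa using this

theorem continuous_dbar {ψ : ℂ → ℂ} (hψ : ContDiff ℝ 1 ψ) : Continuous (dbar ψ) := by
  have h : ∀ v : ℂ, Continuous fun z => fderiv ℝ ψ z v := fun v =>
    (hψ.continuous_fderiv one_ne_zero).clm_apply continuous_const
  exact ((h 1).add (continuous_const.mul (h Complex.I))).div_const 2

theorem dbar_eq_zero_of_notMem_tsupport {ψ : ℂ → ℂ} {z : ℂ} (hz : z ∉ tsupport ψ) :
    dbar ψ z = 0 := by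
  have : fderiv ℝ ψ z = 0 := image_eq_zero_of_notMem_tsupport fun h =>
    hz (tsupport_fderiv_subset ℝ h)
  simp [dbar, this]

theorem hasCompactSupport_dbar {ψ : ℂ → ℂ} (hc : HasCompactSupport ψ) :
    HasCompactSupport (dbar ψ) :=
  hc.mono' fun _ hz => by_contra fun h => hz (dbar_eq_zero_of_notMem_tsupport h)

theorem integral_dbar_eq_zero {ψ : ℂ → ℂ} (hψ : ContDiff ℝ 1 ψ) (hc : HasCompactSupport ψ) :
    ∫ z, dbar ψ z = 0 := by
  have hint : ∀ v, Integrable fun z => fderiv ℝ ψ z v := fun v =>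
    ((hψ.continuous_fderiv one_ne_zero).clm_apply continuous_const).integrable_of_hasCompactSupport
      (hc.fderiv_apply ℝ v)
  simp only [dbar]
  rw [integral_div, integral_add (hint _) ((hint _).const_mul _), integral_const_mul,
    integral_fderiv_apply_eq_zero hψ hc, integral_fderiv_apply_eq_zero hψ hc]
  simp

theorem setIntegral_D_mul_dbar {φ : ℂ → ℂ} (hφ : tsupport φ ⊆ D) (g : ℂ → ℂ) :
    ∫ z in D, g z * dbar φ z = ∫ z, g z * dbar φ z :=
  setIntegral_eq_integral_of_forall_compl_eq_zero fun z hz => by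
    rw [dbar_eq_zero_of_notMem_tsupport fun h => hz (hφ h), mul_zero]

/-- The integrand is `∂(g φ)/∂z̄`. Although `g` is holomorphic only on `D`, the product is smooth on
all of `ℂ` because `φ` vanishes near every point outside its support. -/
theorem integral_holomorphic_mul_dbar_eq_zero {g φ : ℂ → ℂ} (hg : DifferentiableOn ℂ g D)
    (hφ : ContDiff ℝ 1 φ) (hc : HasCompactSupport φ) (hD : tsupport φ ⊆ D) :
    ∫ z, g z * dbar φ z = 0 := by
  have hψ : ContDiff ℝ 1 fun z => g z * φ z := by
    refine contDiff_iff_contDiffAt.2 fun z => ?_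
    by_cases hz : z ∈ tsupport φ
    · have : AnalyticAt ℂ g z := hg.analyticAt (Metric.isOpen_ball.mem_nhds (hD hz))
      exact (this.contDiffAt.restrict_scalars ℝ).mul hφ.contDiffAt
    · refine (contDiffAt_const (c := 0)).congr_of_eventuallyEq ?_
      filter_upwards [(isClosed_tsupport φ).isOpen_compl.mem_nhds hz] with y hy
      rw [image_eq_zero_of_notMem_tsupport hy, mul_zero]
  rw [← integral_dbar_eq_zero hψ hc.mul_left]
  refine integral_congr_ae (Eventually.of_forall fun z => ?_)
  by_cases hz : z ∈ tsupport φ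
  · have hgz : DifferentiableAt ℂ g z := hg.differentiableAt (Metric.isOpen_ball.mem_nhds (hD hz))
    have h1 := hgz.hasDerivAt.hasFDerivAt.restrictScalars ℝ
    have h2 := (h1.mul (hφ.differentiable one_ne_zero z).hasFDerivAt).fderiv
    simp only [dbar]
    rw [show (fun z => g z * φ z) = g * φ from rfl, h2]
    simp
    linear_combination (-1/2 * φ z * deriv g z) * Complex.I_mul_I
  · beta_reduce
    rw [dbar_eq_zero_of_notMem_tsupport hz, mul_zero, dbar_eq_zero_of_notMem_tsupport]
    exact fun h => hz (tsupport_mul_subset_right h)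

/-! ### The Cauchy–Pompeiu formula -/

theorem hasDerivAt_comp_circleMap_radius {ψ : ℂ → ℂ} (hψ : ContDiff ℝ 1 ψ) (r θ : ℝ) :
    HasDerivAt (fun s : ℝ => ψ (circleMap 0 s θ))
      (fderiv ℝ ψ (circleMap 0 r θ) (circleMap 0 1 θ)) r := by
  have h : HasDerivAt (fun s : ℝ => circleMap 0 s θ) (circleMap 0 1 θ) r := by
    have := (Complex.ofRealCLM.hasDerivAt (x := r)).mul_const (Complex.exp (θ * Complex.I))
    simpa [circleMap] using this
  exact (hψ.differentiable one_ne_zero _).hasFDerivAt.comp_hasDerivAt r h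

theorem hasDerivAt_comp_circleMap_angle {ψ : ℂ → ℂ} (hψ : ContDiff ℝ 1 ψ) (r θ : ℝ) :
    HasDerivAt (fun t : ℝ => ψ (circleMap 0 r t))
      (r * fderiv ℝ ψ (circleMap 0 r θ) (circleMap 0 1 θ * Complex.I)) θ := by
  have h := (hψ.differentiable one_ne_zero _).hasFDerivAt.comp_hasDerivAt θ
    (hasDerivAt_circleMap 0 r θ)
  have e : circleMap 0 r θ * Complex.I = r • (circleMap 0 1 θ * Complex.I) := by
    simp [circleMap, mul_assoc]
  rw [e, map_smul, Complex.real_smul] at h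
  exact h

/-- The Cauchy–Riemann operator in the rotated frame (radial, angular), which is what polar
coordinates require. -/
theorem fderiv_rotate (ψ : ℂ → ℂ) (z : ℂ) (θ : ℝ) :
    fderiv ℝ ψ z (circleMap 0 1 θ) + Complex.I * fderiv ℝ ψ z (circleMap 0 1 θ * Complex.I)
      = 2 * (dbar ψ z / circleMap 0 1 θ) := by
  have hc : circleMap 0 1 θ = Real.cos θ + Real.sin θ * Complex.I := by
    simp [circleMap, Complex.exp_mul_I]
  have hne : circleMap 0 1 θ ≠ 0 := circleMap_ne_center one_ne_zero
  have e1 : fderiv ℝ ψ z (circleMap 0 1 θ)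
      = Real.cos θ * fderiv ℝ ψ z 1 + Real.sin θ * fderiv ℝ ψ z Complex.I := by
    have : circleMap 0 1 θ = Real.cos θ • (1 : ℂ) + Real.sin θ • Complex.I := by simp [hc]
    rw [this, map_add, map_smul, map_smul, Complex.real_smul, Complex.real_smul]
  have e2 : fderiv ℝ ψ z (circleMap 0 1 θ * Complex.I)
      = Real.cos θ * fderiv ℝ ψ z Complex.I - Real.sin θ * fderiv ℝ ψ z 1 := by
    have : circleMap 0 1 θ * Complex.I = Real.cos θ • Complex.I - Real.sin θ • (1 : ℂ) := by
      simp only [hc, Complex.real_smul]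
      linear_combination (Real.sin θ : ℂ) * Complex.I_mul_I
    rw [this, map_sub, map_smul, map_smul, Complex.real_smul, Complex.real_smul]
  rw [e1, e2, dbar, mul_div_assoc', eq_div_iff hne, hc]
  have hs : (Real.cos θ : ℂ) ^ 2 + (Real.sin θ : ℂ) ^ 2 = 1 := by
    rw [← Complex.ofReal_pow, ← Complex.ofReal_pow, ← Complex.ofReal_add,
      Real.cos_sq_add_sin_sq, Complex.ofReal_one]
  generalize (Real.cos θ : ℂ) = a at *
  generalize (Real.sin θ : ℂ) = b at *
  linear_combination (fderiv ℝ ψ z 1 + Complex.I * fderiv ℝ ψ z Complex.I) * hs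
    + (- b ^ 2 * fderiv ℝ ψ z 1 + a * b * fderiv ℝ ψ z Complex.I) * Complex.I_mul_I

/-- The Cauchy–Pompeiu formula at the origin for compactly supported functions. -/
theorem integral_dbar_div_self {ψ : ℂ → ℂ} (hψ : ContDiff ℝ 1 ψ) (hc : HasCompactSupport ψ) :
    ∫ z, dbar ψ z / z = -(Real.pi * ψ 0) := by
  obtain ⟨R, hR0, hR⟩ : ∃ R : ℝ, 0 < R ∧ tsupport ψ ⊆ Metric.ball 0 R := by
    obtain ⟨R, hR⟩ := hc.isCompact.isBounded.subset_ball 0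
    exact ⟨max R 1, by positivity, hR.trans (Metric.ball_subset_ball (le_max_left _ _))⟩
  have hout : ∀ z : ℂ, R ≤ ‖z‖ → z ∉ tsupport ψ := fun z hz h => by
    have := hR h
    rw [mem_ball_zero_iff] at this; linarith
  -- `A` is the radial derivative and `B` the angular derivative divided by `r`. The polar Jacobian
  -- cancels `1 / |z|`, so the integrand becomes `(A + i B) / 2`, continuous up to `r = 0`.
  set A : ℝ × ℝ → ℂ := fun p => fderiv ℝ ψ (circleMap 0 p.1 p.2) (circleMap 0 1 p.2) with hA
  set B : ℝ × ℝ → ℂ :=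
    fun p => fderiv ℝ ψ (circleMap 0 p.1 p.2) (circleMap 0 1 p.2 * Complex.I) with hB
  have hcm : Continuous fun p : ℝ × ℝ => circleMap 0 p.1 p.2 := by
    unfold circleMap; fun_prop
  have hcm1 : Continuous fun p : ℝ × ℝ => circleMap 0 1 p.2 := by
    unfold circleMap; fun_prop
  have hfd := (hψ.continuous_fderiv one_ne_zero).comp hcm
  have hAc : Continuous A := hfd.clm_apply hcm1
  have hBc : Continuous B := hfd.clm_apply (hcm1.mul continuous_const)
  have hzero : ∀ r : ℝ, R ≤ r → ∀ θ, fderiv ℝ ψ (circleMap 0 r θ) = 0 := fun r hr θ =>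
    image_eq_zero_of_notMem_tsupport fun h => hout (circleMap 0 r θ)
      (by rw [norm_circleMap_zero]; exact hr.trans (le_abs_self r)) (tsupport_fderiv_subset ℝ h)
  have hint : ∀ F : ℝ × ℝ → ℂ, Continuous F → (∀ p : ℝ × ℝ, R ≤ p.1 → F p = 0) →
      Integrable F ((volume.restrict (Ioi (0 : ℝ))).prod
        (volume.restrict (Ioo (-Real.pi) Real.pi))) := by
    intro F hF h0
    rw [Measure.prod_restrict, ← Measure.volume_eq_prod]
    have h1 : IntegrableOn F (Icc 0 R ×ˢ Icc (-Real.pi) Real.pi) :=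
      hF.continuousOn.integrableOn_compact (isCompact_Icc.prod isCompact_Icc)
    refine (h1.of_forall_sdiff_eq_zero (t := Ioi 0 ×ˢ Icc (-Real.pi) Real.pi)
      (measurableSet_Ioi.prod measurableSet_Icc) fun p hp => h0 p ?_).mono_set
        (prod_mono_right Ioo_subset_Icc_self)
    by_contra! h
    exact hp.2 ⟨⟨(mem_Ioi.1 hp.1.1).le, h.le⟩, hp.1.2⟩
  have hAi := hint A hAc fun p hp => by simp [hA, hzero p.1 hp]
  have hBi := hint B hBc fun p hp => by simp [hB, hzero p.1 hp]
  have hpi := Real.pi_pos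
  have hIA : ∫ p, A p ∂((volume.restrict (Ioi (0 : ℝ))).prod
      (volume.restrict (Ioo (-Real.pi) Real.pi))) = -(2 * Real.pi * ψ 0) := by
    rw [integral_prod_symm _ hAi]
    -- On each ray the fundamental theorem of calculus leaves only the value at the origin.
    have hin : ∀ θ : ℝ, ∫ r in Ioi (0 : ℝ), A (r, θ) = -ψ 0 := by
      intro θ
      have hc1 : Continuous fun r : ℝ => A (r, θ) := hAc.comp (by fun_prop)
      have hi : IntegrableOn (fun r : ℝ => A (r, θ)) (Ioi 0) := by
        have h1 : IntegrableOn (fun r : ℝ => A (r, θ)) (Icc 0 R) :=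
          hc1.continuousOn.integrableOn_compact isCompact_Icc
        refine h1.of_forall_sdiff_eq_zero measurableSet_Ioi fun r hr => ?_
        have : R ≤ r := by
          by_contra! h
          exact hr.2 ⟨(mem_Ioi.1 hr.1).le, h.le⟩
        simp [hA, hzero r this]
      rw [integral_Ioi_of_hasDerivAt_of_tendsto' (f := fun s : ℝ => ψ (circleMap 0 s θ)) (m := 0)
        (fun r _ => hasDerivAt_comp_circleMap_radius hψ r θ) hi]
      · simp
      · refine tendsto_const_nhds.congr' ?_
        filter_upwards [eventually_ge_atTop R] with r hr
        exact (image_eq_zero_of_notMem_tsupport (hout _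
          (by rw [norm_circleMap_zero]; exact hr.trans (le_abs_self r)))).symm
    simp only [hin]
    rw [setIntegral_const, Measure.real, Real.volume_Ioo, ENNReal.toReal_ofReal (by linarith),
      Complex.real_smul]
    push_cast; ring
  have hIB : ∫ p, B p ∂((volume.restrict (Ioi (0 : ℝ))).prod
      (volume.restrict (Ioo (-Real.pi) Real.pi))) = 0 := by
    rw [integral_prod _ hBi]
    -- On each circle an angular derivative is integrated over a full period.
    refine setIntegral_eq_zero_of_forall_eq_zero fun r hr => ?_
    have hr : (r : ℂ) ≠ 0 := by exact_mod_cast (ne_of_gt (mem_Ioi.1 hr))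
    have h1 := intervalIntegral.integral_eq_sub_of_hasDerivAt (a := -Real.pi) (b := Real.pi)
      (fun θ _ => hasDerivAt_comp_circleMap_angle hψ r θ)
      ((continuous_const.mul (hBc.comp (Continuous.prodMk_right r))).intervalIntegrable _ _)
    have h2 : circleMap 0 r (-Real.pi) = circleMap 0 r Real.pi := by
      rw [← periodic_circleMap 0 r (-Real.pi)]; congr 1; ring
    rw [h2, sub_self, intervalIntegral.integral_const_mul, mul_eq_zero] at h1
    have h3 := h1.resolve_left hr
    rw [intervalIntegral.integral_of_le (by linarith), integral_Ioc_eq_integral_Ioo] at h3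
    exact h3
  rw [← Complex.integral_comp_polarCoord_symm, polarCoord_target, Measure.volume_eq_prod,
    ← Measure.prod_restrict]
  have hae : (fun p : ℝ × ℝ => p.1 • (dbar ψ (Complex.polarCoord.symm p) /
      Complex.polarCoord.symm p)) =ᵐ[(volume.restrict (Ioi (0 : ℝ))).prod
        (volume.restrict (Ioo (-Real.pi) Real.pi))]
      fun p => (1 / 2 : ℂ) * (A p + Complex.I * B p) := by
    rw [Measure.prod_restrict]
    filter_upwards [ae_restrict_mem (measurableSet_Ioi.prod measurableSet_Ioo)] with p hp
    have hp0 : (p.1 : ℂ) ≠ 0 := by exact_mod_cast (ne_of_gt (mem_Ioi.1 hp.1))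
    have e : Complex.polarCoord.symm p = circleMap 0 p.1 p.2 := by
      simp [circleMap, Complex.exp_mul_I]
    have e1 : circleMap 0 p.1 p.2 = p.1 * circleMap 0 1 p.2 := by simp [circleMap]
    have hne : circleMap 0 1 p.2 ≠ 0 := circleMap_ne_center one_ne_zero
    rw [hA, hB]
    beta_reduce
    rw [fderiv_rotate, e, Complex.real_smul]
    generalize dbar ψ (circleMap 0 p.1 p.2) = d
    rw [e1]
    field_simp
  rw [integral_congr_ae hae, integral_const_mul, integral_add hAi (hBi.const_mul _),
    integral_const_mul, hIA, hIB]
  ring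

theorem dbar_comp_add (φ : ℂ → ℂ) (ζ z : ℂ) : dbar (fun u => φ (u + ζ)) z = dbar φ (z + ζ) := by
  simp only [dbar, fderiv_comp_add_right]

theorem integral_dbar_div_sub {φ : ℂ → ℂ} (hφ : ContDiff ℝ 1 φ) (hc : HasCompactSupport φ)
    (ζ : ℂ) : ∫ z, dbar φ z / (z - ζ) = -(Real.pi * φ ζ) := by
  rw [← integral_add_right_eq_self _ ζ]
  have h := integral_dbar_div_self (ψ := fun u => φ (u + ζ)) (by fun_prop)
    (hc.comp_homeomorph (Homeomorph.addRight ζ))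
  simpa [dbar_comp_add] using h

/-! ### The differential equation -/

theorem integral_kernel_mul_dbar {f φ : ℂ → ℂ} (hφ : ContDiff ℝ 1 φ) (hc : HasCompactSupport φ)
    (hD : tsupport φ ⊆ D) {ζ : ℂ} (hζ : ζ ∈ D) (h0 : ζ ≠ 0) :
    ∫ z in D, kernel f z ζ * dbar φ z = 2 * Real.pi * (f ζ * φ ζ) := by
  have hζ1 := mem_D.1 hζ
  have hcd := continuous_dbar hφ
  have hB : ∫ z, (1 + z * conj ζ) / (1 - z * conj ζ) * dbar φ z = 0 := by
    refine integral_holomorphic_mul_dbar_eq_zero ?_ hφ hc hD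
    refine DifferentiableOn.div (by fun_prop) (by fun_prop) fun z hz h => ?_
    have h1 : ‖z * conj ζ‖ < 1 := by
      rw [norm_mul, RCLike.norm_conj]
      exact mul_lt_one_of_nonneg_of_lt_one_left (norm_nonneg _) (mem_D.1 hz) hζ1.le
    rw [← sub_eq_zero.1 h, norm_one] at h1
    exact lt_irrefl _ h1
  have hBi : Integrable (fun z => (1 + z * conj ζ) / (1 - z * conj ζ) * dbar φ z)
      (volume.restrict D) := by
    have hcs : HasCompactSupport fun z => (1 + z * conj ζ) / (1 - z * conj ζ) * dbar φ z :=
      (hasCompactSupport_dbar hc).mul_left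
    refine Integrable.integrableOn (Continuous.integrable_of_hasCompactSupport ?_ hcs)
    refine continuous_iff_continuousAt.2 fun z => ?_
    by_cases hz : z ∈ tsupport φ
    · have hne : 1 - z * conj ζ ≠ 0 := fun h => by
        have h1 : ‖z * conj ζ‖ < 1 := by
          rw [norm_mul, RCLike.norm_conj]
          exact mul_lt_one_of_nonneg_of_lt_one_left (norm_nonneg _) (mem_D.1 (hD hz)) hζ1.le
        rw [← sub_eq_zero.1 h, norm_one] at h1
        exact lt_irrefl _ h1
      exact ((by fun_prop : ContinuousAt (fun z : ℂ => 1 + z * conj ζ) z).div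
        (by fun_prop) hne).mul hcd.continuousAt
    · refine (continuousAt_const (y := (0 : ℂ))).congr ?_
      filter_upwards [(isClosed_tsupport φ).isOpen_compl.mem_nhds hz] with y hy
      rw [dbar_eq_zero_of_notMem_tsupport hy, mul_zero]
  obtain ⟨C, hC⟩ := (hasCompactSupport_dbar hc).exists_bound_of_continuous hcd
  have hinv : Integrable (fun z => (z - ζ)⁻¹) (volume.restrict D) := by
    refine ⟨by fun_prop, ?_⟩
    refine lt_of_le_of_lt (lintegral_mono_ae ?_)
      ((lintegral_disk_enorm_sub_inv_le hζ1.le).trans_lt lintegral_ball_enorm_inv_lt_top)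
    have : ∀ᵐ z ∂(volume.restrict D), z ≠ ζ := by
      refine ae_restrict_of_ae ?_
      simp [ae_iff]
    filter_upwards [this] with z hz
    rw [enorm_inv (sub_ne_zero.2 hz), enorm_sub_rev]
  have hAi : Integrable (fun z => dbar φ z / (z - ζ)) (volume.restrict D) := by
    simp only [div_eq_mul_inv]
    exact hinv.bdd_mul hcd.aestronglyMeasurable (Eventually.of_forall hC)
  have hdi : Integrable (dbar φ) (volume.restrict D) :=
    (hcd.integrable_of_hasCompactSupport (hasCompactSupport_dbar hc)).integrableOn
  have hA : ∫ z in D, dbar φ z / (z - ζ) = -(Real.pi * φ ζ) := by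
    rw [← integral_dbar_div_sub hφ hc ζ]
    have := setIntegral_D_mul_dbar hD fun z => (z - ζ)⁻¹
    simpa only [div_eq_inv_mul] using this
  have hd0 : ∫ z in D, dbar φ z = 0 := by
    rw [← integral_dbar_eq_zero hφ hc]
    have := setIntegral_D_mul_dbar hD fun _ => 1
    simpa using this
  have hae : (fun z => kernel f z ζ * dbar φ z) =ᵐ[volume.restrict D] fun z =>
      (-(f ζ / ζ) * dbar φ z + (-2 * f ζ) * (dbar φ z / (z - ζ))) + conj (f ζ) / conj ζ *
        ((1 + z * conj ζ) / (1 - z * conj ζ) * dbar φ z) := by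
    have : ∀ᵐ z ∂(volume.restrict D), z ≠ ζ := by
      refine ae_restrict_of_ae ?_
      simp [ae_iff]
    filter_upwards [this] with z hz
    have h1 : z - ζ ≠ 0 := sub_ne_zero.2 hz
    have h2 : ζ - z ≠ 0 := sub_ne_zero.2 hz.symm
    have h3 : (ζ + z) / (ζ - z) = -1 + (-2 * ζ) / (z - ζ) := by
      field_simp; ring
    -- Of the three resulting terms only the pole contributes: the constant and the holomorphic
    -- fraction integrate to zero against `dbar φ`.
    rw [kernel, h3]
    field_simp
  have hsum : Integrable (fun z => -(f ζ / ζ) * dbar φ z + (-2 * f ζ) * (dbar φ z / (z - ζ)))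
      (volume.restrict D) := (hdi.const_mul _).add (hAi.const_mul _)
  rw [integral_congr_ae hae, integral_add hsum (hBi.const_mul _), integral_add (hdi.const_mul _) (hAi.const_mul _), integral_const_mul,
    integral_const_mul, integral_const_mul, hd0, hA, setIntegral_D_mul_dbar hD, hB]
  ring

theorem integrableOn_opT {f : ℂ → ℂ} (hf : IntegrableOn f D)
    (hf0 : IntegrableOn (fun ζ : ℂ => f ζ / ζ) D) : IntegrableOn (opT f) D :=
  ((integrable_kernel_prod hf hf0).integral_prod_right).const_mul _

/-- Fubini reduces the identity to one `ζ` at a time; the point `ζ = 0`, where the kernel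
degenerates, is null. -/
theorem integral_opT_mul_dbar {f φ : ℂ → ℂ} (hf : IntegrableOn f D)
    (hf0 : IntegrableOn (fun ζ : ℂ => f ζ / ζ) D) (hφ : ContDiff ℝ 1 φ)
    (hc : HasCompactSupport φ) (hD : tsupport φ ⊆ D) :
    ∫ z in D, opT f z * dbar φ z = -∫ z in D, f z * φ z := by
  have hcd := continuous_dbar hφ
  obtain ⟨C, hC⟩ := (hasCompactSupport_dbar hc).exists_bound_of_continuous hcd
  have hi : Integrable (fun p : ℂ × ℂ => kernel f p.2 p.1 * dbar φ p.2)
      ((volume.restrict D).prod (volume.restrict D)) :=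
    (integrable_kernel_prod hf hf0).mul_bdd (hcd.comp continuous_snd).aestronglyMeasurable
      (Eventually.of_forall fun p => hC p.2)
  have h1 : ∀ z, opT f z * dbar φ z
      = -(1 / (2 * (Real.pi : ℂ))) * ∫ ζ in D, kernel f z ζ * dbar φ z := fun z => by
    rw [opT, integral_mul_const, mul_assoc]
  simp only [h1]
  rw [integral_const_mul, ← integral_integral_swap (f := fun ζ z => kernel f z ζ * dbar φ z) hi]
  have hne : ∀ᵐ ζ ∂(volume.restrict D), ζ ≠ 0 := by
    refine ae_restrict_of_ae ?_
    simp [ae_iff]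
  have h2 : (fun ζ => ∫ z in D, kernel f z ζ * dbar φ z) =ᵐ[volume.restrict D]
      fun ζ => 2 * Real.pi * (f ζ * φ ζ) := by
    filter_upwards [hne, ae_restrict_mem measurableSet_D] with ζ h0 hζ
    exact integral_kernel_mul_dbar hφ hc hD hζ h0
  rw [integral_congr_ae h2, integral_const_mul]
  have : (Real.pi : ℂ) ≠ 0 := by simp [Real.pi_ne_zero]
  field_simp

theorem weakDbarEq_schwarzSolution {f h : ℂ → ℂ} {hb : CircleTest → ℂ} (c : ℝ)
    (hf : IntegrableOn f D) (hf0 : IntegrableOn (fun ζ : ℂ => f ζ / ζ) D)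
    (hh : DifferentiableOn ℂ h D) (hbv : HasBoundaryValue (Ioo 0 1) h hb) :
    WeakDbarEq (schwarzSolution f hb c) f := by
  set g : ℂ → ℂ := fun z => Complex.I * ((c - (h 0).im : ℝ) : ℂ) + h z with hg
  have hgd : DifferentiableOn ℂ g D := hh.const_add _
  have hw : EqOn (fun z => g z + opT f z) (schwarzSolution f hb c) D := fun z hz =>
    (schwarzSolution_eq c hh hbv hz).symm
  have hT := integrableOn_opT hf hf0
  have hgl : LocallyIntegrableOn g D := hgd.continuousOn.locallyIntegrableOn measurableSet_D
  refine ⟨?_, fun φ hφ hc hD => ?_⟩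
  · intro z hz
    obtain ⟨s, hs, hs'⟩ := (hgl.add hT.locallyIntegrableOn) z hz
    refine ⟨s ∩ D, inter_mem hs self_mem_nhdsWithin, ?_⟩
    have hae : ∀ᵐ y ∂(volume.restrict (s ∩ D)), y ∈ D := by
      rw [← Measure.restrict_restrict_of_subset (s := s ∩ D) (t := D) inter_subset_right]
      exact ae_restrict_of_ae (ae_restrict_mem measurableSet_D)
    refine (hs'.mono_set inter_subset_left).congr ?_
    filter_upwards [hae] with y hy using hw hy
  · have hφ1 : ContDiff ℝ 1 φ := hφ.of_le (by simp)
    have hcd := continuous_dbar hφ1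
    obtain ⟨C, hC⟩ := (hasCompactSupport_dbar hc).exists_bound_of_continuous hcd
    have hTi : Integrable (fun z => opT f z * dbar φ z) (volume.restrict D) :=
      Integrable.mul_bdd hT hcd.aestronglyMeasurable (Eventually.of_forall hC)
    have hgi : Integrable (fun z => g z * dbar φ z) (volume.restrict D) := by
      have hcs : HasCompactSupport fun z => g z * dbar φ z := (hasCompactSupport_dbar hc).mul_left
      refine Integrable.integrableOn (Continuous.integrable_of_hasCompactSupport ?_ hcs)
      refine continuous_iff_continuousAt.2 fun z => ?_
      by_cases hz : z ∈ tsupport φ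
      · exact (hgd.differentiableAt (Metric.isOpen_ball.mem_nhds (hD hz))).continuousAt.mul
          hcd.continuousAt
      · refine (continuousAt_const (y := (0 : ℂ))).congr ?_
        filter_upwards [(isClosed_tsupport φ).isOpen_compl.mem_nhds hz] with y hy
        rw [dbar_eq_zero_of_notMem_tsupport hy, mul_zero]
    rw [← integral_opT_mul_dbar hf hf0 hφ1 hc hD]
    have h1 : ∫ z in D, schwarzSolution f hb c z * dbar φ z
        = ∫ z in D, (g z * dbar φ z + opT f z * dbar φ z) :=
      setIntegral_congr_fun measurableSet_D fun z hz => by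
        rw [← hw hz, add_mul]
    rw [h1, integral_add hgi hTi, setIntegral_D_mul_dbar hD,
      integral_holomorphic_mul_dbar_eq_zero hgd hφ1 hc hD, zero_add]

/-! ### Circle integrals of the kernel against a test function -/

theorem CircleTest.continuous (φ : CircleTest) : Continuous φ.1 := φ.2.1.continuous

theorem CircleTest.exists_norm_sub_le (φ : CircleTest) :
    ∃ L : ℝ, 0 ≤ L ∧ ∀ θ t, ‖φ.1 θ - φ.1 t‖ ≤ L * ‖circleMap 0 1 θ - circleMap 0 1 t‖ := by
  have hpi := Real.pi_pos
  have hd : Continuous (deriv φ.1) := φ.2.1.continuous_deriv (by simp)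
  have hper : Function.Periodic (deriv φ.1) (2 * Real.pi) := fun x => by
    rw [← deriv_comp_add_const]
    congr 1
    exact funext φ.2.2
  obtain ⟨M, hM⟩ : ∃ M, ∀ x, ‖deriv φ.1 x‖ ≤ M := by
    obtain ⟨M, hM⟩ := isCompact_Icc.exists_bound_of_continuousOn (s := Icc 0 (2 * Real.pi))
      hd.continuousOn
    refine ⟨M, fun x => ?_⟩
    obtain ⟨y, hy, hxy⟩ := hper.exists_mem_Ico₀ Real.two_pi_pos x
    rw [hxy]
    exact hM y (Ico_subset_Icc_self hy)
  have hM0 : 0 ≤ M := (norm_nonneg _).trans (hM 0)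
  refine ⟨M * (Real.pi / 2), by positivity, fun θ t => ?_⟩
  -- Reducing the angular difference to `(-π, π]` makes arc and chord comparable.
  obtain ⟨n, hn, -⟩ := existsUnique_add_zsmul_mem_Ioc Real.two_pi_pos (θ - t) (-Real.pi)
  set u := θ - t + n • (2 * Real.pi) with hu
  have hu1 : |u| ≤ Real.pi := abs_le.2 ⟨by linarith [hn.1], by linarith [hn.2]⟩
  have e : t + u = θ + n • (2 * Real.pi) := by rw [hu]; ring
  have e1 : φ.1 (t + u) = φ.1 θ := by rw [e]; exact φ.2.2.zsmul n θ
  have e2 : circleMap 0 1 (t + u) = circleMap 0 1 θ := by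
    rw [e]; exact (periodic_circleMap 0 1).zsmul n θ
  have h1 := convex_univ.norm_image_sub_le_of_norm_deriv_le (f := φ.1) (C := M)
    (fun x _ => φ.2.1.differentiable (by simp) x) (fun x _ => hM x) (mem_univ t)
    (mem_univ (t + u))
  have h2 := abs_le_norm_circleMap_sub (t := t) hu1
  rw [e1, add_sub_cancel_left, Real.norm_eq_abs] at h1
  rw [e2] at h2
  calc ‖φ.1 θ - φ.1 t‖ ≤ M * |u| := h1
    _ = M * (Real.pi / 2) * (2 / Real.pi * |u|) := by field_simp
    _ ≤ _ := by gcongr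

theorem circleMap_sub_ne_zero {r : ℝ} (hr : 0 < r) {ζ : ℂ} (h : ‖ζ‖ ≠ r) (θ : ℝ) :
    ζ - circleMap 0 r θ ≠ 0 := fun h0 => h <| by
  rw [sub_eq_zero.1 h0, norm_circleMap_zero, abs_of_pos hr]

theorem one_sub_mul_conj_ne_zero {z ζ : ℂ} (hz : ‖z‖ ≤ 1) (hζ : ‖ζ‖ < 1) :
    1 - z * conj ζ ≠ 0 := fun h => by
  have h1 : ‖z * conj ζ‖ < 1 := by
    rw [norm_mul, RCLike.norm_conj]
    exact mul_lt_one_of_nonneg_of_lt_one_right hz (norm_nonneg _) hζ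
  rw [← sub_eq_zero.1 h, norm_one] at h1
  exact lt_irrefl _ h1

theorem continuous_left_factor {r : ℝ} (hr : 0 < r) {ζ : ℂ} (h : ‖ζ‖ ≠ r) :
    Continuous fun θ => (ζ + circleMap 0 r θ) / (ζ - circleMap 0 r θ) :=
  (continuous_const.add (continuous_circleMap 0 r)).div
    (continuous_const.sub (continuous_circleMap 0 r)) (circleMap_sub_ne_zero hr h)

theorem continuous_right_factor {r : ℝ} (hr : 0 < r) (hr1 : r ≤ 1) {ζ : ℂ} (hζ : ‖ζ‖ < 1) :
    Continuous fun θ => (1 + circleMap 0 r θ * conj ζ) / (1 - circleMap 0 r θ * conj ζ) := by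
  have hc := continuous_circleMap 0 r
  exact (continuous_const.add (hc.mul continuous_const)).div
    (continuous_const.sub (hc.mul continuous_const)) fun θ =>
      one_sub_mul_conj_ne_zero (by rwa [norm_circleMap_zero, abs_of_pos hr]) hζ

/-- The integral is `-2π` for `|ζ| < r` (Cauchy's formula) and `2π` for `|ζ| > r` (mean value
property). Only its modulus, the same on both sides, is needed. -/
theorem norm_integral_left_factor {r : ℝ} (hr : 0 < r) {ζ : ℂ} (h : ‖ζ‖ ≠ r) :
    ‖∫ θ in (0 : ℝ)..(2 * Real.pi), (ζ + circleMap 0 r θ) / (ζ - circleMap 0 r θ)‖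
      = 2 * Real.pi := by
  have hpi := Real.pi_pos
  rcases lt_or_gt_of_ne h with h1 | h1
  · have h2 := circleIntegral.integral_sub_inv_of_mem_ball (c := 0) (R := r) (w := ζ) (by simpa)
    rw [circleIntegral] at h2
    have e : ∀ θ : ℝ, (ζ + circleMap 0 r θ) / (ζ - circleMap 0 r θ)
        = 1 + 2 * Complex.I * (deriv (circleMap 0 r) θ • (circleMap 0 r θ - ζ)⁻¹) := fun θ => by
      have h3 := circleMap_sub_ne_zero hr h θ
      have h4 : circleMap 0 r θ - ζ ≠ 0 := by rw [← neg_sub]; exact neg_ne_zero.2 h3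
      rw [deriv_circleMap, smul_eq_mul]
      field_simp
      linear_combination (-2 * circleMap 0 r θ * (ζ - circleMap 0 r θ)) * Complex.I_mul_I
    have hi : IntervalIntegrable
        (fun θ => 2 * Complex.I * (deriv (circleMap 0 r) θ • (circleMap 0 r θ - ζ)⁻¹))
        volume 0 (2 * Real.pi) := by
      refine Continuous.intervalIntegrable ?_ _ _
      exact ((continuous_left_factor hr h).sub (continuous_const (y := (1 : ℂ)))).congr fun θ => by
        rw [Pi.sub_apply, e, add_sub_cancel_left]
    simp only [e]
    rw [intervalIntegral.integral_add (by simp) hi, intervalIntegral.integral_const_mul, h2,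
      intervalIntegral.integral_const, sub_zero]
    have : (2 * Real.pi) • (1 : ℂ) + 2 * Complex.I * (2 * Real.pi * Complex.I)
        = ((-(2 * Real.pi) : ℝ) : ℂ) := by
      rw [Complex.real_smul]; push_cast
      linear_combination (4 * Real.pi : ℂ) * Complex.I_mul_I
    rw [this, Complex.norm_real, norm_neg, Real.norm_of_nonneg (by positivity)]
  · have hζ : ζ ≠ 0 := fun h0 => by rw [h0, norm_zero] at h1; linarith
    have hd : DiffContOnCl ℂ (fun z => (ζ + z) / (ζ - z)) (Metric.ball 0 |r|) := by
      refine DifferentiableOn.diffContOnCl ?_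
      rw [abs_of_pos hr, closure_ball _ hr.ne']
      refine DifferentiableOn.div (by fun_prop) (by fun_prop) fun z hz h0 => ?_
      rw [mem_closedBall_zero_iff, ← sub_eq_zero.1 h0] at hz
      linarith
    have := hd.circleAverage
    rw [Real.circleAverage_def, inv_smul_eq_iff₀ (by positivity)] at this
    rw [this]
    simp [hζ, abs_of_pos hpi]

theorem norm_integral_right_factor {r : ℝ} (hr : 0 < r) (hr1 : r ≤ 1) {ζ : ℂ} (hζ : ‖ζ‖ < 1) :
    ‖∫ θ in (0 : ℝ)..(2 * Real.pi),
      (1 + circleMap 0 r θ * conj ζ) / (1 - circleMap 0 r θ * conj ζ)‖ = 2 * Real.pi := by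
  have hpi := Real.pi_pos
  have hd : DiffContOnCl ℂ (fun z => (1 + z * conj ζ) / (1 - z * conj ζ)) (Metric.ball 0 |r|) := by
    refine DifferentiableOn.diffContOnCl ?_
    rw [abs_of_pos hr, closure_ball _ hr.ne']
    refine DifferentiableOn.div (by fun_prop) (by fun_prop) fun z hz => ?_
    rw [mem_closedBall_zero_iff] at hz
    exact one_sub_mul_conj_ne_zero (hz.trans hr1) hζ
  have := hd.circleAverage
  rw [Real.circleAverage_def, inv_smul_eq_iff₀ (by positivity)] at this
  rw [this]
  simp [abs_of_pos hpi]

theorem norm_integral_mul_le_of_norm_mul_sub_le {F φ : ℝ → ℂ} (hF : Continuous F)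
    (hφ : Continuous φ) (t : ℝ) {K : ℝ} (h : ∀ θ, ‖F θ * (φ θ - φ t)‖ ≤ K) :
    ‖∫ θ in (0 : ℝ)..(2 * Real.pi), F θ * φ θ‖
      ≤ K * (2 * Real.pi) + ‖∫ θ in (0 : ℝ)..(2 * Real.pi), F θ‖ * ‖φ t‖ := by
  have e : ∀ θ, F θ * φ θ = F θ * (φ θ - φ t) + F θ * φ t := fun θ => by ring
  have h1 : Continuous fun θ => F θ * (φ θ - φ t) := hF.mul (hφ.sub continuous_const)
  have h2 : Continuous fun θ => F θ * φ t := hF.mul continuous_const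
  simp only [e]
  rw [intervalIntegral.integral_add (h1.intervalIntegrable _ _) (h2.intervalIntegrable _ _),
    intervalIntegral.integral_mul_const]
  refine (norm_add_le _ _).trans (add_le_add ?_ (norm_mul_le _ _))
  have := intervalIntegral.norm_integral_le_of_norm_le_const (a := 0) (b := 2 * Real.pi)
    (fun θ _ => h θ)
  rwa [sub_zero, abs_of_pos Real.two_pi_pos] at this

/-- Subtracting the value at `arg ζ` makes the integrand bounded, by the Lipschitz estimate; the
subtracted part is an explicit circle integral of modulus `2π`. No bound on `∫ dθ / |ζ - z|` is
used. -/
theorem exists_norm_integral_factor_mul_le (φ : CircleTest) :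
    ∃ C : ℝ, 0 ≤ C ∧ ∀ r : ℝ, 1 / 2 ≤ r → r < 1 → ∀ ζ ∈ D, ‖ζ‖ ≠ r →
      ‖∫ θ in (0 : ℝ)..(2 * Real.pi),
        (ζ + circleMap 0 r θ) / (ζ - circleMap 0 r θ) * φ.1 θ‖ ≤ C ∧
      ‖∫ θ in (0 : ℝ)..(2 * Real.pi),
        (1 + circleMap 0 r θ * conj ζ) / (1 - circleMap 0 r θ * conj ζ) * φ.1 θ‖ ≤ C := by
  obtain ⟨L, hL0, hL⟩ := φ.exists_norm_sub_le
  obtain ⟨M, hM⟩ : ∃ M, ∀ x, ‖φ.1 x‖ ≤ M := by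
    obtain ⟨M, hM⟩ := isCompact_Icc.exists_bound_of_continuousOn (s := Icc 0 (2 * Real.pi))
      φ.continuous.continuousOn
    refine ⟨M, fun x => ?_⟩
    obtain ⟨y, hy, hxy⟩ := φ.2.2.exists_mem_Ico₀ Real.two_pi_pos x
    rw [hxy]
    exact hM y (Ico_subset_Icc_self hy)
  have hM0 : 0 ≤ M := (norm_nonneg _).trans (hM 0)
  have hpi := Real.pi_pos
  -- `8 * L` is the numerator bound `2` times `4 * L`; the `4` is `2 / r` at its worst, `r = 1 / 2`.
  refine ⟨8 * L * (2 * Real.pi) + 2 * Real.pi * M, by positivity, fun r hr hr1 ζ hζ hne => ?_⟩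
  have hr0 : 0 < r := by linarith
  have hζ1 := mem_D.1 hζ
  have hz : ∀ θ, ‖circleMap 0 r θ‖ < 1 := fun θ => by
    rwa [norm_circleMap_zero, abs_of_pos hr0]
  have hsub : ∀ θ, ‖φ.1 θ - φ.1 ζ.arg‖ ≤ 4 * L * ‖ζ - circleMap 0 r θ‖ := fun θ => by
    have h1 := norm_circleMap_one_sub_le hr0 θ ζ
    have h2 : ‖circleMap 0 1 θ - circleMap 0 1 ζ.arg‖ ≤ 4 * ‖ζ - circleMap 0 r θ‖ := by
      nlinarith [norm_nonneg (circleMap 0 1 θ - circleMap 0 1 ζ.arg)]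
    calc _ ≤ _ := hL θ ζ.arg
      _ ≤ L * (4 * ‖ζ - circleMap 0 r θ‖) := by gcongr
      _ = _ := by ring
  have hfac : ∀ (θ : ℝ) (a b : ℂ), ‖a‖ ≤ 2 → ‖ζ - circleMap 0 r θ‖ ≤ ‖b‖ →
      ‖a / b * (φ.1 θ - φ.1 ζ.arg)‖ ≤ 8 * L := fun θ a b ha hb => by
    have hpos : 0 < ‖ζ - circleMap 0 r θ‖ := norm_pos_iff.2 (circleMap_sub_ne_zero hr0 hne θ)
    rw [norm_mul, norm_div]
    calc ‖a‖ / ‖b‖ * ‖φ.1 θ - φ.1 ζ.arg‖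
        ≤ 2 / ‖ζ - circleMap 0 r θ‖ * (4 * L * ‖ζ - circleMap 0 r θ‖) := by
          gcongr; exact hsub θ
      _ = 8 * L := by field_simp; ring
  constructor
  · refine (norm_integral_mul_le_of_norm_mul_sub_le (continuous_left_factor hr0 hne)
      φ.continuous ζ.arg fun θ => hfac θ _ _ ?_ le_rfl).trans ?_
    · linarith [norm_add_le ζ (circleMap 0 r θ), hz θ]
    · rw [norm_integral_left_factor hr0 hne]
      gcongr
      exact hM _
  · refine (norm_integral_mul_le_of_norm_mul_sub_le (continuous_right_factor hr0 hr1.le hζ1)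
      φ.continuous ζ.arg fun θ => hfac θ _ _ ?_
        (norm_sub_le_norm_one_sub_mul_conj (hz θ).le hζ1.le)).trans ?_
    · refine (norm_add_le _ _).trans ?_
      rw [norm_one, norm_mul, RCLike.norm_conj]
      linarith [mul_le_one₀ (hz θ).le (norm_nonneg ζ) hζ1.le]
    · rw [norm_integral_right_factor hr0 hr1.le hζ1]
      gcongr
      exact hM _

theorem exists_norm_integral_kernel_mul_le (f : ℂ → ℂ) (φ : CircleTest) :
    ∃ C : ℝ, ∀ r : ℝ, 1 / 2 ≤ r → r < 1 → ∀ ζ ∈ D, ‖ζ‖ ≠ r →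
      ‖∫ θ in (0 : ℝ)..(2 * Real.pi), kernel f (circleMap 0 r θ) ζ * φ.1 θ‖
        ≤ C * ‖f ζ / ζ‖ := by
  obtain ⟨C, hC0, hC⟩ := exists_norm_integral_factor_mul_le φ
  refine ⟨2 * C, fun r hr hr1 ζ hζ hne => ?_⟩
  obtain ⟨h1, h2⟩ := hC r hr hr1 ζ hζ hne
  have hr0 : 0 < r := by linarith
  have hA : Continuous fun θ =>
      f ζ / ζ * ((ζ + circleMap 0 r θ) / (ζ - circleMap 0 r θ) * φ.1 θ) :=
    continuous_const.mul ((continuous_left_factor hr0 hne).mul φ.continuous)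
  have hB : Continuous fun θ => conj (f ζ) / conj ζ *
      ((1 + circleMap 0 r θ * conj ζ) / (1 - circleMap 0 r θ * conj ζ) * φ.1 θ) :=
    continuous_const.mul ((continuous_right_factor hr0 hr1.le (mem_D.1 hζ)).mul φ.continuous)
  simp only [kernel, add_mul, mul_assoc]
  rw [intervalIntegral.integral_add (hA.intervalIntegrable _ _) (hB.intervalIntegrable _ _),
    intervalIntegral.integral_const_mul, intervalIntegral.integral_const_mul]
  refine (norm_add_le _ _).trans ?_
  rw [norm_mul, norm_mul, ← map_div₀, RCLike.norm_conj]
  calc _ ≤ ‖f ζ / ζ‖ * C + ‖f ζ / ζ‖ * C := by gcongr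
    _ = _ := by ring

theorem tendsto_integral_kernel_mul (f : ℂ → ℂ) (φ : CircleTest) {ζ : ℂ} (hζ : ζ ∈ D) :
    Tendsto (fun r : ℝ => ∫ θ in (0 : ℝ)..(2 * Real.pi), kernel f (circleMap 0 r θ) ζ * φ.1 θ)
      (𝓝[<] 1)
      (𝓝 (∫ θ in (0 : ℝ)..(2 * Real.pi), kernel f (circleMap 0 1 θ) ζ * φ.1 θ)) := by
  have hζ1 := mem_D.1 hζ
  -- Radii beyond `1 - δ = |ζ| + δ` keep the circle at distance at least `δ` from `ζ`.
  set δ := (1 - ‖ζ‖) / 2 with hδ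
  have hδ0 : 0 < δ := by linarith
  have hcont : ∀ r : ℝ, r ≤ 1 → 1 - δ < r →
      Continuous fun θ => kernel f (circleMap 0 r θ) ζ * φ.1 θ := fun r hr1 hr => by
    have hr0 : 0 < r := by linarith [norm_nonneg ζ]
    exact ((continuous_const.mul (continuous_left_factor hr0 (by linarith))).add
      (continuous_const.mul (continuous_right_factor hr0 hr1 hζ1))).mul φ.continuous
  have hev : ∀ᶠ r in 𝓝[<] (1 : ℝ), r < 1 ∧ 1 - δ < r := by
    filter_upwards [self_mem_nhdsWithin,
      mem_nhdsWithin_of_mem_nhds (lt_mem_nhds (show 1 - δ < 1 by linarith))] with r h1 h2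
    exact ⟨h1, h2⟩
  refine intervalIntegral.tendsto_integral_filter_of_dominated_convergence
    (fun θ => ‖f ζ / ζ‖ * (4 / δ) * ‖φ.1 θ‖) ?_ ?_ ?_ ?_
  · filter_upwards [hev] with r hr
    exact (hcont r hr.1.le hr.2).aestronglyMeasurable
  · filter_upwards [hev] with r hr
    refine Eventually.of_forall fun θ _ => ?_
    have hr0 : 0 < r := by linarith [norm_nonneg ζ]
    have hn : ‖circleMap 0 r θ‖ = r := by rw [norm_circleMap_zero, abs_of_pos hr0]
    have h1 : δ ≤ ‖ζ - circleMap 0 r θ‖ := by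
      have := norm_sub_norm_le (circleMap 0 r θ) ζ
      rw [norm_sub_rev, hn] at this
      linarith [hr.2]
    have h2 : δ ≤ ‖1 - circleMap 0 r θ * conj ζ‖ :=
      h1.trans (norm_sub_le_norm_one_sub_mul_conj (hn.trans_le hr.1.le) hζ1.le)
    have h3 : ‖ζ + circleMap 0 r θ‖ ≤ 2 := by linarith [norm_add_le ζ (circleMap 0 r θ), hr.1]
    have h4 : ‖1 + circleMap 0 r θ * conj ζ‖ ≤ 2 := by
      refine (norm_add_le _ _).trans ?_
      rw [norm_one, norm_mul, RCLike.norm_conj, hn]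
      linarith [mul_le_one₀ hr.1.le (norm_nonneg ζ) hζ1.le]
    rw [norm_mul]
    gcongr
    rw [kernel]
    refine (norm_add_le _ _).trans ?_
    rw [norm_mul, norm_mul, ← map_div₀, RCLike.norm_conj, norm_div (_ + _), norm_div (1 + _)]
    calc _ ≤ ‖f ζ / ζ‖ * (2 / δ) + ‖f ζ / ζ‖ * (2 / δ) := by gcongr
      _ = _ := by ring
  · exact (continuous_const.mul φ.continuous.norm).intervalIntegrable _ _
  · refine Eventually.of_forall fun θ _ => ?_
    have hz : Tendsto (fun r : ℝ => circleMap 0 r θ) (𝓝[<] 1) (𝓝 (circleMap 0 1 θ)) := by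
      have : Continuous fun r : ℝ => circleMap 0 r θ := by unfold circleMap; fun_prop
      exact (this.tendsto 1).mono_left nhdsWithin_le_nhds
    have hk : ContinuousAt (fun z => kernel f z ζ) (circleMap 0 1 θ) := by
      refine (continuousAt_const.mul ((by fun_prop : ContinuousAt (fun z => ζ + z) _).div
        (by fun_prop) (circleMap_sub_ne_zero one_pos hζ1.ne θ))).add
        (continuousAt_const.mul ((by fun_prop : ContinuousAt (fun z => 1 + z * conj ζ) _).div
        (by fun_prop) (one_sub_mul_conj_ne_zero (by simp) hζ1)))
    exact (hk.tendsto.comp hz).mul_const _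

/-! ### Boundary values and their real parts -/

/-- With `conj z = 1 / z`, the two fractions of the kernel are negatives of each other's conjugates,
so the kernel is a difference of conjugate numbers. -/
theorem conj_kernel_of_norm_eq_one (f : ℂ → ℂ) {z ζ : ℂ} (hz : ‖z‖ = 1) (hζ : ζ ∈ D) :
    conj (kernel f z ζ) = -kernel f z ζ := by
  have hζ1 := mem_D.1 hζ
  have hzz : z * conj z = 1 := by rw [Complex.mul_conj, Complex.normSq_eq_norm_sq, hz]; simp
  have hd1 : ζ - z ≠ 0 := fun h => by
    rw [sub_eq_zero.1 h] at hζ1; linarith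
  have hd2 : 1 - z * conj ζ ≠ 0 := one_sub_mul_conj_ne_zero hz.le hζ1
  have key : conj ((ζ + z) / (ζ - z)) = -((1 + z * conj ζ) / (1 - z * conj ζ)) := by
    have hd3 : conj ζ - conj z ≠ 0 := by rwa [← map_sub, map_ne_zero]
    rw [map_div₀, map_add, map_sub, ← neg_div, div_eq_div_iff hd3 hd2]
    linear_combination (-2 * conj ζ) * hzz
  have key' : (1 + z * conj ζ) / (1 - z * conj ζ) = -conj ((ζ + z) / (ζ - z)) := by
    rw [key, neg_neg]
  rw [kernel, key', ← map_div₀]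
  simp only [map_add, map_mul, map_neg, Complex.conj_conj]
  ring

/-- The boundary value of `𝒯_D(f)` on the unit circle. -/
noncomputable def boundaryOpT (f : ℂ → ℂ) (φ : CircleTest) : ℂ :=
  -(1 / (2 * (Real.pi : ℂ))) *
    ∫ ζ in D, ∫ θ in (0 : ℝ)..(2 * Real.pi), kernel f (circleMap 0 1 θ) ζ * φ.1 θ

theorem ae_norm_ne (r : ℝ) : ∀ᵐ ζ ∂(volume.restrict D), ‖ζ‖ ≠ r := by
  refine ae_restrict_of_ae ?_
  rw [ae_iff]
  have : {ζ : ℂ | ¬‖ζ‖ ≠ r} = Metric.sphere 0 r := by ext; simp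
  rw [this]
  exact Measure.addHaar_sphere volume 0 r

theorem hasBoundaryValue_opT {f : ℂ → ℂ} (hf0 : IntegrableOn (fun ζ : ℂ => f ζ / ζ) D) :
    HasBoundaryValue (admissibleRadii f) (opT f) (boundaryOpT f) := by
  have hpi := Real.two_pi_pos
  refine ⟨fun r hr => ?_, fun φ => ?_⟩
  · rw [intervalIntegrable_iff_integrableOn_Ioc_of_le hpi.le]
    exact hr.2.integral_prod_right.const_mul _
  have hI : ∀ r ∈ admissibleRadii f, Integrable (fun p : ℂ × ℝ =>
      kernel f (circleMap 0 r p.2) p.1 * φ.1 p.2)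
      ((volume.restrict D).prod (volume.restrict (Ioc 0 (2 * Real.pi)))) := fun r hr => by
    obtain ⟨M, hM⟩ := isCompact_Icc.exists_bound_of_continuousOn (s := Icc 0 (2 * Real.pi))
      φ.continuous.continuousOn
    refine hr.2.mul_bdd (c := M) (φ.continuous.comp continuous_snd).aestronglyMeasurable ?_
    have : ∀ᵐ p ∂((volume.restrict D).prod (volume.restrict (Ioc 0 (2 * Real.pi)))),
        p ∈ D ×ˢ Ioc (0 : ℝ) (2 * Real.pi) := by
      rw [Measure.prod_restrict]
      exact ae_restrict_mem (measurableSet_D.prod measurableSet_Ioc)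
    filter_upwards [this] with p hp
    exact hM _ (Ioc_subset_Icc_self hp.2)
  have hlim : Tendsto (fun r : ℝ => ∫ ζ in D, ∫ θ in (0 : ℝ)..(2 * Real.pi),
      kernel f (circleMap 0 r θ) ζ * φ.1 θ) (𝓝[admissibleRadii f ∩ Iio 1] 1)
      (𝓝 (∫ ζ in D, ∫ θ in (0 : ℝ)..(2 * Real.pi), kernel f (circleMap 0 1 θ) ζ * φ.1 θ)) := by
    obtain ⟨C, hC⟩ := exists_norm_integral_kernel_mul_le f φ
    refine tendsto_integral_filter_of_dominated_convergence (fun ζ => C * ‖f ζ / ζ‖) ?_ ?_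
      (hf0.norm.const_mul _) ?_
    · filter_upwards [self_mem_nhdsWithin] with r hr
      simp only [intervalIntegral.integral_of_le hpi.le]
      exact (hI r hr.1).aestronglyMeasurable.integral_prod_right'
    · filter_upwards [self_mem_nhdsWithin, mem_nhdsWithin_of_mem_nhds
        (le_mem_nhds (show (1 / 2 : ℝ) < 1 by norm_num))] with r hr hr2
      -- The uniform bound fails to cover only `|ζ| = r`, a null set.
      filter_upwards [ae_norm_ne r, ae_restrict_mem measurableSet_D] with ζ hne hζ
      exact hC r hr2 hr.2 ζ hζ hne
    · filter_upwards [ae_restrict_mem measurableSet_D] with ζ hζ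
      exact (tendsto_integral_kernel_mul f φ hζ).mono_left
        (nhdsWithin_mono _ inter_subset_right)
  refine (hlim.const_mul (-(1 / (2 * (Real.pi : ℂ))))).congr' ?_
  filter_upwards [self_mem_nhdsWithin] with r hr
  simp only [intervalIntegral.integral_of_le hpi.le]
  -- Admissibility of `r`, through `hI`, is what permits this exchange.
  rw [integral_integral_swap (f := fun ζ θ => kernel f (circleMap 0 r θ) ζ * φ.1 θ) (hI r hr.1),
    ← integral_const_mul]
  refine integral_congr_ae (Eventually.of_forall fun θ => ?_)
  simp only [opT, integral_mul_const, mul_assoc]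

theorem conj_boundaryOpT_conjTest (f : ℂ → ℂ) (φ : CircleTest) :
    conj (boundaryOpT f (conjTest φ)) = -boundaryOpT f φ := by
  have h : ∀ ζ ∈ D, conj (∫ θ in (0 : ℝ)..(2 * Real.pi),
      kernel f (circleMap 0 1 θ) ζ * (conjTest φ).1 θ)
      = -∫ θ in (0 : ℝ)..(2 * Real.pi), kernel f (circleMap 0 1 θ) ζ * φ.1 θ := fun ζ hζ => by
    rw [← intervalIntegral.integral_neg]
    simp only [intervalIntegral.integral_of_le Real.two_pi_pos.le]
    rw [← integral_conj]
    refine integral_congr_ae (Eventually.of_forall fun θ => ?_)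
    simp only [conjTest, map_mul, Complex.conj_conj]
    rw [conj_kernel_of_norm_eq_one f (by simp) hζ, neg_mul]
  rw [boundaryOpT, boundaryOpT, map_mul, ← integral_conj,
    setIntegral_congr_fun measurableSet_D h, integral_neg]
  simp [map_ofNat]

theorem hasBoundaryValue_const (E : Set ℝ) (k : ℂ) :
    HasBoundaryValue E (fun _ => k) fun φ => ∫ θ in (0 : ℝ)..(2 * Real.pi), k * φ.1 θ :=
  ⟨fun _ _ => intervalIntegrable_const, fun _ => tendsto_const_nhds⟩

theorem HasBoundaryValue.mono {E F : Set ℝ} {u : ℂ → ℂ} {T : CircleTest → ℂ}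
    (h : HasBoundaryValue F u T) (hEF : E ⊆ F) : HasBoundaryValue E u T :=
  ⟨fun r hr => h.1 r (hEF hr), fun φ =>
    (h.2 φ).mono_left (nhdsWithin_mono _ (inter_subset_inter_left _ hEF))⟩

theorem HasBoundaryValue.add {E : Set ℝ} {u v : ℂ → ℂ} {S T : CircleTest → ℂ}
    (hu : HasBoundaryValue E u S) (hv : HasBoundaryValue E v T) :
    HasBoundaryValue E (fun z => u z + v z) fun φ => S φ + T φ := by
  refine ⟨fun r hr => (hu.1 r hr).add (hv.1 r hr), fun φ => ?_⟩
  refine ((hu.2 φ).add (hv.2 φ)).congr' ?_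
  filter_upwards [self_mem_nhdsWithin] with r hr
  simp only [add_mul]
  exact (intervalIntegral.integral_add
    ((hu.1 r hr.1).mul_continuousOn φ.continuous.continuousOn)
    ((hv.1 r hr.1).mul_continuousOn φ.continuous.continuousOn)).symm

theorem HasBoundaryValue.congr {E : Set ℝ} {u v : ℂ → ℂ} {T : CircleTest → ℂ}
    (h : HasBoundaryValue E u T) (hE : E ⊆ Ioo 0 1) (huv : EqOn u v D) :
    HasBoundaryValue E v T := by
  have e : ∀ r ∈ E, ∀ θ, u (circleMap 0 r θ) = v (circleMap 0 r θ) := fun r hr θ => huv <| by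
    rw [mem_D, norm_circleMap_zero, abs_of_pos (hE hr).1]
    exact (hE hr).2
  refine ⟨fun r hr => ?_, fun φ => (h.2 φ).congr' ?_⟩
  · simpa only [e r hr] using h.1 r hr
  · filter_upwards [self_mem_nhdsWithin] with r hr
    simp only [e r hr.1]

theorem rePart_add (S T : CircleTest → ℂ) (φ : CircleTest) :
    rePart (fun φ => S φ + T φ) φ = rePart S φ + rePart T φ := by
  simp only [rePart, map_add]
  ring

theorem exists_hasBoundaryValue_schwarzSolution {f h : ℂ → ℂ} {hb : CircleTest → ℂ} (c : ℝ)
    (hf0 : IntegrableOn (fun ζ : ℂ => f ζ / ζ) D)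
    (hh : DifferentiableOn ℂ h D) (hbv : HasBoundaryValue (Ioo 0 1) h hb) :
    ∃ wb : CircleTest → ℂ,
      HasBoundaryValue (admissibleRadii f) (schwarzSolution f hb c) wb ∧
      ∀ φ, rePart wb φ = rePart hb φ := by
  have hE : admissibleRadii f ⊆ Ioo 0 1 := fun r hr => hr.1
  -- The boundary value is that of an imaginary constant, of `h` and of `𝒯_D(f)` added together; the
  -- first and the last have zero real part.
  refine ⟨_, (((hasBoundaryValue_const _ (Complex.I * ((c - (h 0).im : ℝ) : ℂ))).add
    (hbv.mono hE)).add (hasBoundaryValue_opT hf0)).congr hE fun z hz =>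
      (schwarzSolution_eq c hh hbv hz).symm, fun φ => ?_⟩
  rw [rePart_add, rePart_add]
  have h1 : rePart (boundaryOpT f) φ = 0 := by
    rw [rePart, conj_boundaryOpT_conjTest, add_neg_cancel, zero_div]
  have h2 : ∀ k : ℝ, rePart (fun φ => ∫ θ in (0 : ℝ)..(2 * Real.pi),
      Complex.I * (k : ℂ) * φ.1 θ) φ = 0 := fun k => by
    have : conj (∫ θ in (0 : ℝ)..(2 * Real.pi), Complex.I * (k : ℂ) * (conjTest φ).1 θ)
        = -∫ θ in (0 : ℝ)..(2 * Real.pi), Complex.I * (k : ℂ) * φ.1 θ := by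
      rw [← intervalIntegral.integral_neg]
      simp only [intervalIntegral.integral_of_le Real.two_pi_pos.le]
      rw [← integral_conj]
      refine integral_congr_ae (Eventually.of_forall fun θ => ?_)
      simp [conjTest]
    rw [rePart, this, add_neg_cancel, zero_div]
  rw [h1, h2]
  ring

end SchwarzDisk

theorem mainTheorem1
    (f h : ℂ → ℂ) (hb : SchwarzDisk.CircleTest → ℂ) (c : ℝ)
    (hf : IntegrableOn f SchwarzDisk.D)
    (hf0 : IntegrableOn (fun ζ : ℂ => f ζ / ζ) SchwarzDisk.D)
    (hh : DifferentiableOn ℂ h SchwarzDisk.D)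
    (hbv : SchwarzDisk.HasBoundaryValue (Ioo 0 1) h hb) :
    -- the integral defining the solution converges at almost every point of the disk and at `0`
    (∀ᵐ z ∂(volume.restrict SchwarzDisk.D),
      IntegrableOn (SchwarzDisk.kernel f z) SchwarzDisk.D) ∧
    IntegrableOn (SchwarzDisk.kernel f 0) SchwarzDisk.D ∧
    -- the differential equation
    SchwarzDisk.WeakDbarEq (SchwarzDisk.schwarzSolution f hb c) f ∧
    -- the boundary condition
    (∀ᵐ r ∂(volume.restrict (Ioo (0 : ℝ) 1)), r ∈ SchwarzDisk.admissibleRadii f) ∧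
    ((∃ q : ENNReal, 1 < q ∧ MemLp f q (volume.restrict SchwarzDisk.D)) →
      SchwarzDisk.admissibleRadii f = Ioo 0 1) ∧
    (∃ wb : SchwarzDisk.CircleTest → ℂ,
      SchwarzDisk.HasBoundaryValue (SchwarzDisk.admissibleRadii f)
        (SchwarzDisk.schwarzSolution f hb c) wb ∧
      ∀ φ : SchwarzDisk.CircleTest,
        SchwarzDisk.rePart wb φ = SchwarzDisk.rePart hb φ) ∧
    -- the pointwise condition
    (SchwarzDisk.schwarzSolution f hb c 0).im = c := by

  exact ⟨SchwarzDisk.integrableOn_kernel_ae hf hf0, SchwarzDisk.integrableOn_kernel_zero hf0,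
    SchwarzDisk.weakDbarEq_schwarzSolution c hf hf0 hh hbv,
    SchwarzDisk.ae_mem_admissibleRadii hf hf0,
    fun ⟨_, hq, hfq⟩ => SchwarzDisk.admissibleRadii_eq_of_memLp hf hf0 hq hfq,
    SchwarzDisk.exists_hasBoundaryValue_schwarzSolution c hf0 hh hbv,
    SchwarzDisk.schwarzSolution_zero_im c hh hbv⟩
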